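/- Work in ZFC. Let $\kappa$ be a measurable cardinal and let $\mathfrak{U}_\kappa$ be the set of non-principal $\kappa$-complete ultrafilters over $\kappa$. For ultrafilters $U_0,U_1$ write $U_0\le_{\mathrm{RK}}U_1$ if there is a function $\pi$ from the underlying set of $U_1$ to that of $U_0$ such that $X\in U_0\Leftrightarrow \pi^{-1}(X)\in U_1$ for every $X$. For a cardinal $\theta$, $\langle\mathfrak{U}_\kappa,\le_{\mathrm{RK}}\rangle$ is $\theta$-directed if every family of fewer than $\theta$ members of $\mathfrak{U}_\kappa$ has a $\le_{\mathrm{RK}}$-upper bound in $\mathfrak{U}_\kappa$. For an ordinal $\alpha\ge\omega$, $\kappa$ has the $\alpha$-Gluing Property ($\alpha$-GP) if for every sequence $\langle U_\beta\mid\beta<\alpha\rangle$ of members of $\mathfrak{U}_\kappa$ there are a definable (with parameters) elementary embedding $j\colon V\to M$ into a transitive class $M$ with $\mathrm{crit}(j)=\kappa$ and $M^\kappa\subseteq M$, and a strictly increasing sequence of ordinals $\langle\eta_\beta\mid\beta<\alpha\rangle$, such that $U_\beta=\{X\subseteq\kappa\mid\eta_\beta\in j(X)\}$ for all $\beta<\alpha$.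 The weak $\alpha$-GP is the same except that $\langle\eta_\beta\mid\beta<\alpha\rangle$ need not be increasing. The (weak) $\alpha$-GP holds via ultrafilters if $j$ can always be taken to be the ultrapower embedding $j_W\colon V\to M_W$ by a $\kappa$-complete ultrafilter $W$ on $\kappa^{<\kappa}$. The ${<}\alpha$-GP (via ultrafilters) means the $\beta$-GP (via ultrafilters) for all ordinals $\beta$ with $\omega\le\beta<\alpha$. **Theorem.** Let $\kappa$ be a measurable cardinal and let $\lambda$ be an infinite cardinal with $\lambda\le 2^\kappa$. Then the following are equivalent: 1. $\kappa$ has the ${<}\lambda^+$-GP via ultrafilters; 2. $\kappa$ has the $\lambda$-GP via ultrafilters; 3. $\kappa$ has the weak $\lambda$-GP via ultrafilters; 4. $\langle\mathfrak{U}_\kappa,\le_{\mathrm{RK}}\rangle$ is $\lambda^+$-directed. Moreover, if $\lambda\le\kappa$, then (1), (2) and (3) are, respectively, equivalent to * (1') $\kappa$ has the ${<}\lambda^+$-GP; * (2') $\kappa$ has the $\lambda$-GP; * (3') $\kappa$ has the weak $\lambda$-GP. -/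

import Mathlib

open Cardinal Ordinal FirstOrder

universe u

noncomputable section

namespace Gluing

/-! ### Ultrafilters over a cardinal and the Rudin–Keisler order -/

/-- The underlying set of `κ`: the well-ordered type of all ordinals below `κ`. -/
abbrev Pt (κ : Cardinal.{u}) : Type u := κ.ord.ToType

/-- `κ^{<κ}`: sequences of elements of `κ`, indexed by a proper initial segment of `κ`
(equivalently, by an ordinal below `κ`). -/
abbrev SeqLT (κ : Cardinal.{u}) : Type u := Σ a : Pt κ, (Set.Iio a → Pt κ)

/-- `κ`-completeness: closure under intersections of fewer than `κ` sets. -/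
def IsComplete {I : Type u} (κ : Cardinal.{u}) (U : Ultrafilter I) : Prop :=
  CardinalInterFilter (U : Filter I) κ

/-- `𝔘_κ`: the `κ`-complete non-principal ultrafilters over `κ`. -/
def CompleteUltrafilters (κ : Cardinal.{u}) : Set (Ultrafilter (Pt κ)) :=
  {U | IsComplete κ U ∧ ∀ a : Pt κ, ({a} : Set (Pt κ)) ∉ U}

/-- `κ` is measurable: uncountable and carrying a `κ`-complete non-principal ultrafilter. -/
def IsMeasurable (κ : Cardinal.{u}) : Prop :=
  ℵ₀ < κ ∧ (CompleteUltrafilters κ).Nonempty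

/-- The Rudin–Keisler order on ultrafilters. -/
def RKLE {A B : Type u} (U₀ : Ultrafilter A) (U₁ : Ultrafilter B) : Prop :=
  ∃ π : B → A, ∀ X : Set A, X ∈ U₀ ↔ π ⁻¹' X ∈ U₁

/-- `⟨𝔘_κ, ≤_RK⟩` is `θ`-directed: every family of fewer than `θ` members of `𝔘_κ` has an
upper bound in `𝔘_κ`. -/
def RKDirected (κ θ : Cardinal.{u}) : Prop :=
  ∀ (ι : Type u) (U : ι → Ultrafilter (Pt κ)), #ι < θ → (∀ i, U i ∈ CompleteUltrafilters κ) →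
    ∃ W ∈ CompleteUltrafilters κ, ∀ i, RKLE (U i) W

/-! ### Elementary embeddings of the universe of sets -/

/-- The relation symbols of the language of set theory: one binary symbol. -/
inductive SetRel : ℕ → Type
  | mem : SetRel 2

/-- The first-order language of set theory. -/
def setLang : Language := ⟨fun _ => Empty, SetRel⟩

/-- The universe `V` of sets as a structure `(V, ∈)`. -/
instance structureV : setLang.Structure ZFSet.{u} where
  funMap := fun f => f.elim
  RelMap | .mem => fun x => x 0 ∈ x 1

/-- A class `M` of sets as a structure `(M, ∈)`. -/
instance structureClass (M : Set ZFSet.{u}) : setLang.Structure M where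
  funMap := fun f => f.elim
  RelMap | .mem => fun x => (x 0 : ZFSet.{u}) ∈ (x 1 : ZFSet.{u})

/-- A (definable) elementary embedding `j : V → M` into a transitive class `M` with
`crit(j) = κ` and `M^κ ⊆ M`. Elementarity is part of the type of `j`. -/
structure IsClosedEmbedding (κ : Cardinal.{u}) {M : Set ZFSet.{u}}
    (j : ZFSet.{u} ↪ₑ[setLang] M) : Prop where
  /-- `M` is a transitive class. -/
  transitive : ∀ x ∈ M, ∀ y ∈ x, y ∈ M
  /-- `j` is first-order definable, with parameters, over `(V, ∈)`. -/
  definable : (Set.univ : Set ZFSet.{u}).Definable₂ setLang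
    {p : ZFSet.{u} × ZFSet.{u} | (j p.1 : ZFSet.{u}) = p.2}
  /-- `j` fixes all ordinals below `κ`. -/
  fix_below : ∀ ξ : Ordinal.{u}, ξ < κ.ord → (j ξ.toZFSet : ZFSet.{u}) = ξ.toZFSet
  /-- `j` moves `κ`. -/
  move_crit : (j κ.ord.toZFSet : ZFSet.{u}) ≠ κ.ord.toZFSet
  /-- Every function with domain `κ` and values in `M` belongs to `M`. -/
  closed : ∀ f y : ZFSet.{u}, ZFSet.IsFunc κ.ord.toZFSet y f → (∀ z ∈ y, z ∈ M) → f ∈ M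

/-- `j : V → M` is the ultrapower embedding `j_W : V → M_W`: an isomorphism `π` identifies the
ultrapower of `(V, ∈)` by `W` with the transitive class `M`, and `j(x) = π([c_x]_W)`, where `c_x`
is the constant function with value `x`. -/
def IsUltrapowerEmbedding {I : Type u} (W : Ultrafilter I) {M : Set ZFSet.{u}}
    (j : ZFSet.{u} ↪ₑ[setLang] M) : Prop :=
  (∀ x ∈ M, ∀ y ∈ x, y ∈ M) ∧
  ∃ π : (W : Filter I).Germ ZFSet.{u} ≃ M,
    (∀ f g : I → ZFSet.{u},
      (π (f : (W : Filter I).Germ ZFSet.{u}) : ZFSet.{u}) ∈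
          (π (g : (W : Filter I).Germ ZFSet.{u}) : ZFSet.{u}) ↔
        ∀ᶠ i in (W : Filter I), f i ∈ g i) ∧
    ∀ x : ZFSet.{u}, j x = π ((fun _ : I => x : I → ZFSet.{u}) : (W : Filter I).Germ ZFSet.{u})

/-- A subset `X ⊆ κ` as an element of the universe of sets (a set of von Neumann ordinals). -/
def subsetCode {κ : Cardinal.{u}} (X : Set (Pt κ)) : ZFSet.{u} :=
  ZFSet.range fun a : X => (a.1.toOrd : Ordinal.{u}).toZFSet

/-- `U = {X ⊆ κ | η ∈ j(X)}`. -/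
def IsSeed {κ : Cardinal.{u}} {M : Set ZFSet.{u}} (j : ZFSet.{u} ↪ₑ[setLang] M)
    (η : Ordinal.{u}) (U : Ultrafilter (Pt κ)) : Prop :=
  ∀ X : Set (Pt κ), X ∈ U ↔ η.toZFSet ∈ (j (subsetCode X) : ZFSet.{u})

/-! ### The Gluing Property and its variants -/

/-- The `α`-Gluing Property of `κ`. -/
def HasGP (κ : Cardinal.{u}) (α : Ordinal.{u}) : Prop :=
  ∀ U : Set.Iio α → Ultrafilter (Pt κ), (∀ β, U β ∈ CompleteUltrafilters κ) →
    ∃ (M : Set ZFSet.{u}) (j : ZFSet.{u} ↪ₑ[setLang] M) (η : Set.Iio α → Ordinal.{u}),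
      IsClosedEmbedding κ j ∧ StrictMono η ∧ ∀ β, IsSeed j (η β) (U β)

/-- The weak `α`-Gluing Property of `κ`: the seeds need not be increasing. -/
def HasWeakGP (κ : Cardinal.{u}) (α : Ordinal.{u}) : Prop :=
  ∀ U : Set.Iio α → Ultrafilter (Pt κ), (∀ β, U β ∈ CompleteUltrafilters κ) →
    ∃ (M : Set ZFSet.{u}) (j : ZFSet.{u} ↪ₑ[setLang] M) (η : Set.Iio α → Ordinal.{u}),
      IsClosedEmbedding κ j ∧ ∀ β, IsSeed j (η β) (U β)

/-- The `α`-Gluing Property of `κ` via ultrafilters: the gluing embedding is the ultrapower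
embedding of a `κ`-complete ultrafilter on `κ^{<κ}`. -/
def HasGPViaUltrafilters (κ : Cardinal.{u}) (α : Ordinal.{u}) : Prop :=
  ∀ U : Set.Iio α → Ultrafilter (Pt κ), (∀ β, U β ∈ CompleteUltrafilters κ) →
    ∃ (W : Ultrafilter (SeqLT κ)) (M : Set ZFSet.{u}) (j : ZFSet.{u} ↪ₑ[setLang] M)
      (η : Set.Iio α → Ordinal.{u}),
      IsComplete κ W ∧ IsUltrapowerEmbedding W j ∧
      IsClosedEmbedding κ j ∧ StrictMono η ∧ ∀ β, IsSeed j (η β) (U β)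

/-- The weak `α`-Gluing Property of `κ` via ultrafilters. -/
def HasWeakGPViaUltrafilters (κ : Cardinal.{u}) (α : Ordinal.{u}) : Prop :=
  ∀ U : Set.Iio α → Ultrafilter (Pt κ), (∀ β, U β ∈ CompleteUltrafilters κ) →
    ∃ (W : Ultrafilter (SeqLT κ)) (M : Set ZFSet.{u}) (j : ZFSet.{u} ↪ₑ[setLang] M)
      (η : Set.Iio α → Ordinal.{u}),
      IsComplete κ W ∧ IsUltrapowerEmbedding W j ∧
      IsClosedEmbedding κ j ∧ ∀ β, IsSeed j (η β) (U β)

/-- The `<α`-Gluing Property: the `β`-Gluing Property for all infinite ordinals `β < α`. -/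
def HasGPBelow (κ : Cardinal.{u}) (α : Ordinal.{u}) : Prop :=
  ∀ β : Ordinal.{u}, ω ≤ β → β < α → HasGP κ β

/-- The `<α`-Gluing Property via ultrafilters. -/
def HasGPBelowViaUltrafilters (κ : Cardinal.{u}) (α : Ordinal.{u}) : Prop :=
  ∀ β : Ordinal.{u}, ω ≤ β → β < α → HasGPViaUltrafilters κ β

end Gluing

end

/-! Everything passes through directedness: each gluing hypothesis yields Rudin–Keisler upper
bounds, and directedness yields the strongest form of gluing.

From directedness to gluing (`RKDirected.exists_glues`, `RKDirected.hasGPViaUltrafilters`): by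
induction on `β < λ⁺` one finds a single `W` with functions `f γ` that project `W` to `U γ` and
increase modulo `W`. One further ultrafilter is glued by the product `W ⊗ U β`. To reach `β`, take
an upper bound of ultrafilters that glue `γ + 1` terms for each `γ < β`. This gives many candidates
for the `δ`-th function, and their `W`-least choices turn out to be increasing. In the ultrapower by
`W` the classes of these functions are ordinals, and they are the required seeds. The ultrapower is
built by hand: transitive collapse (`coll`), Łoś's theorem, closure under `κ`-sequences
(`ultraClass_closed`), and a first-order definition of `j_W` by set-sized pieces of the collapse
(`definable_ultraEmb`).

From gluing via ultrafilters to directedness: a seed in `M_W` is represented by a function that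
projects `W` to the ultrafilter in question (`exists_map_of_isSeed`). Since `κ` is inaccessible,
`κ^{<κ}` has size at most `κ`, so `W` can be moved to `κ` (`IsMeasurable.exists_upperBound`).

For `λ ≤ κ` an arbitrary closed embedding suffices: the sequence of seeds is padded to a function `κ
→ j(κ)`, which lies in `M` by closure and in `j(κ^{<κ})` because `κ < j(κ)`. It therefore generates
an ultrafilter on `κ^{<κ}`, and evaluation at the `a`-th place projects this to the `a`-th
ultrafilter (`IsClosedEmbedding.exists_ultrafilter`). -/

noncomputable section

namespace Gluing

/-! ### Complete ultrafilters -/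

section Complete

variable {κ : Cardinal.{u}} {I : Type u} {W : Ultrafilter I}

theorem IsComplete.eventually_forall (hW : IsComplete κ W) {ι : Type u} (hι : #ι < κ)
    {p : I → ι → Prop} (h : ∀ x, ∀ᶠ i in (W : Filter I), p i x) :
    ∀ᶠ i in (W : Filter I), ∀ x, p i x := by
  have : CardinalInterFilter (W : Filter I) κ := hW
  exact (Filter.eventually_cardinal_forall hι).2 h

theorem IsComplete.exists_eventually (hW : IsComplete κ W) {ι : Type u} (hι : #ι < κ)
    {p : I → ι → Prop} (h : ∀ᶠ i in (W : Filter I), ∃ x, p i x) :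
    ∃ x, ∀ᶠ i in (W : Filter I), p i x := by
  by_contra! hc
  have h' : ∀ᶠ i in (W : Filter I), ∀ x, ¬ p i x :=
    hW.eventually_forall hι hc
  obtain ⟨i, ⟨x, hx⟩, hi⟩ := (h.and h').exists
  exact hi x hx

theorem IsComplete.map (hW : IsComplete κ W) {J : Type u} (f : I → J) :
    IsComplete κ (W.map f) := by
  have : CardinalInterFilter (W : Filter I) κ := hW
  change CardinalInterFilter ((W : Filter I).map f) κ
  infer_instance

/-- A descending chain modulo `W` involves countably many large sets; at a point common to all of
them it would descend in `R` itself. -/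
theorem IsComplete.wellFounded (hκ : ℵ₀ < κ) (hW : IsComplete κ W) {X : Type*}
    {R : X → X → Prop} (hR : WellFounded R) :
    WellFounded fun g h : I → X => ∀ᶠ i in (W : Filter I), R (g i) (h i) := by
  have : CardinalInterFilter (W : Filter I) κ := hW
  have : CountableInterFilter (W : Filter I) := CardinalInterFilter.toCountableInterFilter _ hκ
  rw [wellFounded_iff_isEmpty_descending_chain]
  refine ⟨fun ⟨f, hf⟩ => ?_⟩
  obtain ⟨i, hi⟩ := (eventually_countable_forall.2 hf).exists
  exact (wellFounded_iff_isEmpty_descending_chain.1 hR).false ⟨fun n => f n i, hi⟩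

theorem notMem_of_mk_lt {U : Ultrafilter (Pt κ)} (hU : U ∈ CompleteUltrafilters κ)
    {X : Set (Pt κ)} (hX : #X < κ) : X ∉ U := fun h => by
  have : ∀ᶠ i in (U : Filter (Pt κ)), ∃ x : X, i = (x : Pt κ) := Filter.mem_of_superset h fun i hi =>
    ⟨⟨i, hi⟩, rfl⟩
  obtain ⟨x, hx⟩ := hU.1.exists_eventually hX this
  exact hU.2 x hx

theorem mk_Iio_pt_lt (a : Pt κ) : #(Set.Iio a) < κ := by
  simpa using mk_Iio_lt a (by simp)

theorem mk_Iic_lt (hκ : ℵ₀ < κ) (a : Pt κ) : #(Set.Iic a) < κ := by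
  rw [← Set.Iio_insert]
  exact (mk_insert_le).trans_lt (add_lt_of_lt hκ.le (mk_Iio_pt_lt a)
    (one_lt_aleph0.trans hκ))

theorem eventually_gt {U : Ultrafilter (Pt κ)} (hκ : ℵ₀ < κ) (hU : U ∈ CompleteUltrafilters κ)
    (a : Pt κ) : ∀ᶠ i in (U : Filter (Pt κ)), a < i := by
  have := notMem_of_mk_lt hU (mk_Iic_lt hκ a)
  rw [← Ultrafilter.compl_mem_iff_notMem] at this
  exact Filter.mem_of_superset this fun i (hi : ¬ i ≤ a) => not_le.1 hi

theorem mem_completeUltrafilters_of_map {W U : Ultrafilter (Pt κ)} (hW : IsComplete κ W)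
    (hU : U ∈ CompleteUltrafilters κ) {f : Pt κ → Pt κ} (h : W.map f = U) :
    W ∈ CompleteUltrafilters κ := by
  refine ⟨hW, fun a ha => hU.2 (f a) ?_⟩
  rw [← h, Ultrafilter.mem_map]
  exact Filter.mem_of_superset ha fun i hi => by simp_all

theorem rkle_iff_exists_map {A B : Type u} {U₀ : Ultrafilter A} {U₁ : Ultrafilter B} :
    RKLE U₀ U₁ ↔ ∃ f, U₁.map f = U₀ :=
  exists_congr fun f => ⟨fun h => Ultrafilter.ext fun X => (h X).symm, fun h X => by rw [← h]; rfl⟩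

end Complete

/-! ### Measurable cardinals are inaccessible -/

section Inaccessible

variable {κ : Cardinal.{u}}

/-- If `κ` injected into the subsets of a set `M` of size `μ`, completeness would decide each `m :
M` simultaneously on one large set. All its points then have the same image, so it is a singleton.
-/
theorem IsMeasurable.two_power_lt (hκ : IsMeasurable κ) {μ : Cardinal.{u}} (hμ : μ < κ) :
    2 ^ μ < κ := by
  obtain ⟨h0, U, hU⟩ := hκ
  by_contra! h
  obtain ⟨M, rfl⟩ : ∃ M : Type u, #M = μ := ⟨μ.out, mk_out μ⟩
  rw [← mk_set, ← mk_ord_toType κ] at h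
  obtain ⟨e⟩ := h
  have key : ∀ᶠ a in (U : Filter (Pt κ)), ∀ m : M,
      (m ∈ e a ↔ ∀ᶠ b in (U : Filter (Pt κ)), m ∈ e b) := by
    refine hU.1.eventually_forall hμ fun m => ?_
    by_cases hm : ∀ᶠ b in (U : Filter (Pt κ)), m ∈ e b
    · filter_upwards [hm] with a ha
      simp [ha, hm]
    · filter_upwards [Ultrafilter.eventually_not.2 hm] with a ha
      simp [ha, hm]
  obtain ⟨a, ha⟩ := key.exists
  refine hU.2 a (Filter.mem_of_superset key fun b hb => e.injective ?_)
  ext m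
  rw [hb m, ha m]

theorem IsMeasurable.exists_bound (hκ : IsMeasurable κ) (a : Pt κ) (t : Set.Iio a → Pt κ) :
    ∃ b, ∀ x, t x < b := by
  obtain ⟨h0, U, hU⟩ := hκ
  exact (hU.1.eventually_forall (mk_Iio_pt_lt a) fun x => eventually_gt h0 hU (t x)).exists

/-- A sequence is bounded, hence determined by its length, a bound and a map between two proper
initial segments; strong limitness leaves fewer than `κ` such maps for each pair. -/
theorem IsMeasurable.mk_seqLT_le (hκ : IsMeasurable κ) : #(SeqLT κ) ≤ κ := by
  choose b hb using hκ.exists_bound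
  have hinj : Function.Injective (fun t : SeqLT κ =>
      (⟨t.1, b t.1 t.2, fun x => ⟨t.2 x, hb t.1 t.2 x⟩⟩ :
        Σ a : Pt κ, Σ c : Pt κ, (Set.Iio a → Set.Iio c))) := by
    rintro ⟨a, t⟩ ⟨a', t'⟩ h
    obtain rfl : a = a' := congrArg Sigma.fst h
    simp only [Sigma.mk.injEq, heq_eq_eq, true_and] at h
    obtain ⟨h1, h2⟩ := h
    congr 1
    funext x
    have : ∀ (c c' : Pt κ) (p : Set.Iio a → Set.Iio c) (p' : Set.Iio a → Set.Iio c'), c = c' → p ≍ p' →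
        (p x).1 = (p' x).1 := by
      rintro c _ p p' rfl h
      rw [eq_of_heq h]
    exact this _ _ _ _ h1 h2
  refine (mk_le_of_injective hinj).trans ?_
  have h0 := hκ.1.le
  have hle : ∀ a c : Pt κ, #(Set.Iio a → Set.Iio c) ≤ κ := fun a c => by
    rw [← power_def]
    refine (power_le_power_right (cantor _).le).trans ?_
    rw [← power_mul]
    exact (hκ.two_power_lt (mul_lt_of_lt h0 (mk_Iio_pt_lt c)
      (mk_Iio_pt_lt a))).le
  have hsum : ∀ f : Pt κ → Cardinal.{u}, (∀ a, f a ≤ κ) → Cardinal.sum f ≤ κ := fun f hf => by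
    refine (sum_le_sum f (fun _ => κ) hf).trans ?_
    rw [sum_const', mk_ord_toType, mul_eq_self h0]
  rw [mk_sigma]
  refine hsum _ fun a => ?_
  rw [mk_sigma]
  exact hsum _ fun c => hle a c

end Inaccessible

/-! ### Gluing by a single ultrafilter -/

section Combinatorial

variable {κ : Cardinal.{u}}

/-- The product `W ⊗ U` of ultrafilters. -/
def ultraProd {A B : Type*} (W : Ultrafilter A) (U : Ultrafilter B) : Ultrafilter (A × B) :=
  W.bind fun a => U.map (Prod.mk a)

theorem eventually_ultraProd {A B : Type*} {W : Ultrafilter A} {U : Ultrafilter B}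
    {p : A × B → Prop} : (∀ᶠ x in (ultraProd W U : Filter (A × B)), p x) ↔
      ∀ᶠ a in (W : Filter A), ∀ᶠ b in (U : Filter B), p (a, b) := by
  exact Iff.rfl

theorem isComplete_iff {I : Type u} {W : Ultrafilter I} : IsComplete κ W ↔
    ∀ (ι : Type u) (p : I → ι → Prop), #ι < κ → (∀ x, ∀ᶠ i in (W : Filter I), p i x) →
      ∀ᶠ i in (W : Filter I), ∀ x, p i x := by
  refine ⟨fun hW ι p hι h => hW.eventually_forall hι h, fun h => ⟨fun S hS hS' => ?_⟩⟩
  have := h S (fun i s => i ∈ (s : Set I)) hS fun s => hS' s s.2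
  filter_upwards [this] with i hi
  simpa using hi

theorem IsComplete.ultraProd {A B : Type u} {W : Ultrafilter A} {U : Ultrafilter B}
    (hW : IsComplete κ W) (hU : IsComplete κ U) : IsComplete κ (ultraProd W U) := by
  refine isComplete_iff.2 fun ι p hι h => ?_
  rw [eventually_ultraProd]
  have := hW.eventually_forall hι fun x => eventually_ultraProd.1 (h x)
  filter_upwards [this] with a ha
  exact hU.eventually_forall hι ha

/-- `W` glues `⟨U γ | γ < β⟩`: the `U γ` are the projections of `W` under functions `f γ` that
increase modulo `W`. -/
def Glues (β : Ordinal.{u}) (U : Ordinal.{u} → Ultrafilter (Pt κ)) (W : Ultrafilter (Pt κ))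
    (f : Ordinal.{u} → Pt κ → Pt κ) : Prop :=
  (∀ γ < β, W.map (f γ) = U γ) ∧
    ∀ γ < β, ∀ δ < γ, ∀ᶠ i in (W : Filter (Pt κ)), f δ i < f γ i

/-- In `W ⊗ U β` the old functions read the first coordinate and the new one reads the second. For a
fixed first coordinate, `U β`-almost every second coordinate lies above the old value. -/
theorem Glues.exists_succ (hκ : ℵ₀ < κ) {β : Ordinal.{u}} {U : Ordinal.{u} → Ultrafilter (Pt κ)}
    (hU : ∀ γ, U γ ∈ CompleteUltrafilters κ) {W : Ultrafilter (Pt κ)}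
    (hW : W ∈ CompleteUltrafilters κ) {f : Ordinal.{u} → Pt κ → Pt κ} (h : Glues β U W f) :
    ∃ W' ∈ CompleteUltrafilters κ, ∃ f', Glues (β + 1) U W' f' := by
  have hcard : #(Pt κ × Pt κ) = #(Pt κ) := by
    rw [← mul_def, mul_eq_self (by rw [mk_ord_toType]; exact hκ.le)]
  obtain ⟨e⟩ := Cardinal.eq.1 hcard
  classical
  let f' : Ordinal.{u} → Pt κ → Pt κ := fun γ i =>
    if γ < β then f γ (e.symm i).1 else (e.symm i).2
  have hlast : ∀ γ, ¬ γ < β → ((ultraProd W (U β)).map e).map (f' γ) = U β := fun γ hγ => by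
    ext X
    change (∀ᶠ x in (ultraProd W (U β) : Filter _), f' γ (e x) ∈ X) ↔ _
    simp only [eventually_ultraProd, f', hγ, if_false, Equiv.symm_apply_apply,
      Filter.eventually_const]
    rfl
  refine ⟨(ultraProd W (U β)).map e, mem_completeUltrafilters_of_map
    ((hW.1.ultraProd (hU β).1).map e) (hU β) (hlast β (lt_irrefl _)), f', fun γ hγ => ?_,
    fun γ hγ δ hδ => ?_⟩
  · rcases (Order.lt_add_one_iff.1 hγ).lt_or_eq with hγ' | rfl
    · rw [← h.1 γ hγ']
      ext X
      change (∀ᶠ x in (ultraProd W (U β) : Filter _), f' γ (e x) ∈ X) ↔ _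
      simp only [eventually_ultraProd, f', hγ', if_true, Equiv.symm_apply_apply,
        Filter.eventually_const]
      rfl
    · exact hlast γ (lt_irrefl _)
  · have hδ' : δ < β := hδ.trans_le (Order.lt_add_one_iff.1 hγ)
    change (∀ᶠ x in (ultraProd W (U β) : Filter _), f' δ (e x) < f' γ (e x))
    simp only [eventually_ultraProd, f', hδ', if_true, Equiv.symm_apply_apply]
    rcases (Order.lt_add_one_iff.1 hγ).lt_or_eq with hγ' | rfl
    · simp only [hγ', if_true, Filter.eventually_const]
      exact h.2 γ hγ' δ hδ
    · simp only [lt_irrefl, if_false]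
      exact Filter.Eventually.of_forall fun i => eventually_gt hκ (hU γ) _

theorem RKDirected.exists_glues (hκ : ℵ₀ < κ) {lam : Cardinal.{u}}
    (hdir : RKDirected κ (Order.succ lam)) {U : Ordinal.{u} → Ultrafilter (Pt κ)}
    (hU : ∀ γ, U γ ∈ CompleteUltrafilters κ) (β : Ordinal.{u}) (hβ : β < (Order.succ lam).ord) :
    ∃ W ∈ CompleteUltrafilters κ, ∃ f, Glues β U W f := by
  induction β using WellFoundedLT.induction with
  | ind β ih =>
  have hsucc : ∀ γ : β.ToType, ∃ W ∈ CompleteUltrafilters κ, ∃ f,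
      Glues ((γ.toOrd : Ordinal.{u}) + 1) U W f := fun γ => by
    obtain ⟨W, hW, f, hf⟩ := ih γ.toOrd γ.toOrd.2 (lt_trans γ.toOrd.2 hβ)
    exact hf.exists_succ hκ hU hW
  choose V hV f hf using hsucc
  obtain ⟨W, hW, hle⟩ := hdir β.ToType V (by rw [mk_toType]; exact lt_ord.1 hβ) hV
  simp only [rkle_iff_exists_map] at hle
  choose ρ hρ using hle
  have hwf := hW.1.wellFounded hκ (wellFounded_lt (α := Pt κ))
  -- Candidates for the `δ`-th function: the `δ`-th functions of all `V γ` with `γ ≥ δ`, pulled back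
  -- to `W`. A `W`-least one exists by well-foundedness.
  let S : Ordinal.{u} → Set (Pt κ → Pt κ) := fun δ =>
    {g | ∃ γ : β.ToType, δ ≤ (γ.toOrd : Ordinal.{u}) ∧ g = f γ δ ∘ ρ γ}
  have hS : ∀ δ, ∃ g, δ < β → g ∈ S δ ∧ ∀ g' ∈ S δ, ¬ ∀ᶠ i in (W : Filter _), g' i < g i :=
    fun δ => by
      by_cases hδ : δ < β
      · obtain ⟨g, hg, hg'⟩ := hwf.has_min (S δ) ⟨_, ToType.mk ⟨δ, hδ⟩, by simp, rfl⟩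
        exact ⟨g, fun _ => ⟨hg, hg'⟩⟩
      · exact ⟨id, fun h => absurd h hδ⟩
  choose g hg using hS
  refine ⟨W, hW, g, fun γ hγ => ?_, fun γ hγ δ hδ => ?_⟩
  · obtain ⟨⟨ε, hε, h⟩, -⟩ := hg γ hγ
    rw [h, ← (hf ε).1 γ (Order.lt_add_one_iff.2 hε), ← hρ ε, Ultrafilter.map_map]
  · obtain ⟨⟨ε, hε, h⟩, -⟩ := hg γ hγ
    -- The ultrafilter `V ε` that supplied the `γ`-th function also supplies a `δ`-th one strictly
    -- below it, and the least `δ`-th candidate is no larger than that.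
    have h1 := (hg δ (hδ.trans hγ)).2 (f ε δ ∘ ρ ε) ⟨ε, hδ.le.trans hε, rfl⟩
    have h2 := (hf ε).2 γ (Order.lt_add_one_iff.2 hε) δ hδ
    rw [← hρ ε] at h2
    rw [← Ultrafilter.eventually_not] at h1
    filter_upwards [h1, show ∀ᶠ i in (W : Filter _), f ε δ (ρ ε i) < f ε γ (ρ ε i) from h2]
      with i hi1 hi2
    rw [h]
    exact (not_lt.1 hi1).trans_lt hi2

end Combinatorial

/-! ### The transitive collapse of an ultrapower of the universe -/

section Ultrapower

variable {I : Type u} {W : Ultrafilter I}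

/-- The membership relation of the ultrapower of `(V, ∈)` by `W`, on representatives. -/
abbrev UMem (W : Ultrafilter I) (g h : I → ZFSet.{u}) : Prop :=
  ∀ᶠ i in (W : Filter I), g i ∈ h i

/-- The transitive collapse of the ultrapower of `(V, ∈)` by `W`, on representatives. -/
def coll (hwf : WellFounded (UMem W)) : (I → ZFSet.{u}) → ZFSet.{u} :=
  -- Only representatives with values in `f i` or equal to `∅` are collected, so that the index type
  -- is small. The value `∅` serves where `g i ∉ f i`; every `W`-member of `f` agrees modulo `W`
  -- with such a representative.
  hwf.fix fun f ih => ZFSet.range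
    fun g : {g : ∀ i, (insert ∅ (f i) : ZFSet.{u}) // UMem W (fun i => (g i).1) f} =>
      ih (fun i => (g.1 i).1) g.2

variable (hwf : WellFounded (UMem W))

theorem coll_eq (f : I → ZFSet.{u}) : coll hwf f = ZFSet.range
    fun g : {g : ∀ i, (insert ∅ (f i) : ZFSet.{u}) // UMem W (fun i => (g i).1) f} =>
      coll hwf (fun i => (g.1 i).1) := by
  rw [coll, hwf.fix_eq]

theorem mem_coll_iff_restricted {f : I → ZFSet.{u}} {z : ZFSet.{u}} : z ∈ coll hwf f ↔
    ∃ g : I → ZFSet.{u}, (∀ i, g i = ∅ ∨ g i ∈ f i) ∧ UMem W g f ∧ coll hwf g = z := by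
  rw [coll_eq, ZFSet.mem_range]
  constructor
  · rintro ⟨g, rfl⟩
    exact ⟨fun i => (g.1 i).1, fun i => ZFSet.mem_insert_iff.1 (g.1 i).2, g.2, rfl⟩
  · rintro ⟨g, hg, hgf, rfl⟩
    exact ⟨⟨fun i => ⟨g i, ZFSet.mem_insert_iff.2 (hg i)⟩, hgf⟩, rfl⟩

open Classical in
theorem exists_restricted {g f : I → ZFSet.{u}} (h : UMem W g f) :
    ∃ g' : I → ZFSet.{u}, (∀ i, g' i = ∅ ∨ g' i ∈ f i) ∧ UMem W g' f ∧ g =ᶠ[(W : Filter I)] g' := by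
  have h' : ∀ᶠ i in (W : Filter I), g i = if g i ∈ f i then g i else ∅ := by
    filter_upwards [h] with i hi
    rw [if_pos hi]
  refine ⟨fun i => if g i ∈ f i then g i else ∅, fun i => ?_, ?_, h'⟩
  · by_cases hi : g i ∈ f i <;> simp [hi]
  · filter_upwards [h] with i hi
    rw [if_pos hi]
    exact hi

theorem coll_congr {f f' : I → ZFSet.{u}} (h : f =ᶠ[(W : Filter I)] f') :
    coll hwf f = coll hwf f' := by
  induction f using hwf.induction generalizing f' with
  | _ f ih =>
  have key : ∀ g, UMem W g f → UMem W g f' := fun g hg => by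
    filter_upwards [hg, h] with i h1 h2
    rwa [← h2]
  have key' : ∀ g, UMem W g f' → UMem W g f := fun g hg => by
    filter_upwards [hg, h] with i h1 h2
    rwa [h2]
  ext z
  rw [mem_coll_iff_restricted, mem_coll_iff_restricted]
  constructor
  · rintro ⟨g, -, hgf, rfl⟩
    obtain ⟨g', h1, h2, h3⟩ := exists_restricted (key g hgf)
    exact ⟨g', h1, h2, (ih g hgf h3).symm⟩
  · rintro ⟨g, -, hgf, rfl⟩
    obtain ⟨g', h1, h2, h3⟩ := exists_restricted (key' g hgf)
    exact ⟨g', h1, h2, ih g' h2 h3.symm⟩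

theorem mem_coll_iff {f : I → ZFSet.{u}} {z : ZFSet.{u}} : z ∈ coll hwf f ↔
    ∃ g : I → ZFSet.{u}, UMem W g f ∧ coll hwf g = z := by
  rw [mem_coll_iff_restricted]
  constructor
  · rintro ⟨g, -, h⟩
    exact ⟨g, h⟩
  · rintro ⟨g, hg, rfl⟩
    obtain ⟨g', h1, h2, h3⟩ := exists_restricted hg
    exact ⟨g', h1, h2, (coll_congr hwf h3).symm⟩

theorem exists_umem_of_not {f g : I → ZFSet.{u}}
    (h : ∀ᶠ i in (W : Filter I), ∃ x ∈ f i, x ∉ g i) : ∃ k, UMem W k f ∧ ¬ UMem W k g := by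
  obtain ⟨k, hk⟩ := h.choice
  refine ⟨k, hk.mono fun i h => h.1, Ultrafilter.eventually_not.1 (hk.mono fun i h => h.2)⟩

/-- If `f` and `g` differ on a large set, one of the two inclusions fails on a large set, and
choosing witnesses gives a `W`-member of one that is not a `W`-member of the other. -/
theorem coll_eq_iff {f g : I → ZFSet.{u}} :
    coll hwf f = coll hwf g ↔ f =ᶠ[(W : Filter I)] g := by
  refine ⟨fun h => ?_, coll_congr hwf⟩
  induction f using hwf.induction generalizing g with
  | _ f ih =>
  by_contra hne
  have hne' : ∀ᶠ i in (W : Filter I), (∃ x ∈ f i, x ∉ g i) ∨ ∃ x ∈ g i, x ∉ f i := by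
    filter_upwards [Ultrafilter.eventually_not.2 hne] with i hi
    by_contra! hc
    exact hi (ZFSet.ext fun x => ⟨hc.1 x, hc.2 x⟩)
  rcases Ultrafilter.eventually_or.1 hne' with h1 | h1
  · obtain ⟨k, hk, hk'⟩ := exists_umem_of_not h1
    obtain ⟨k', h2, h3⟩ := (mem_coll_iff hwf).1 (h ▸ (mem_coll_iff hwf).2 ⟨k, hk, rfl⟩)
    refine hk' ?_
    filter_upwards [h2, ih k hk h3.symm] with i hi hi'
    rwa [hi']
  · obtain ⟨k, hk, hk'⟩ := exists_umem_of_not h1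
    obtain ⟨k', h2, h3⟩ := (mem_coll_iff hwf).1 (h ▸ (mem_coll_iff hwf).2 ⟨k, hk, rfl⟩)
    refine hk' ?_
    filter_upwards [h2, ih k' h2 h3] with i hi hi'
    rwa [← hi']

theorem coll_mem_coll_iff {f g : I → ZFSet.{u}} :
    coll hwf f ∈ coll hwf g ↔ UMem W f g := by
  rw [mem_coll_iff]
  constructor
  · rintro ⟨k, hk, h⟩
    filter_upwards [hk, (coll_eq_iff hwf).1 h] with i hi hi'
    rwa [← hi']
  · exact fun h => ⟨f, h, rfl⟩

/-- The transitive class `M_W`. -/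
def ultraClass : Set ZFSet.{u} := Set.range (coll hwf)

/-- The element of `M_W` represented by a function. -/
def toUltra (f : I → ZFSet.{u}) : ultraClass hwf := ⟨coll hwf f, f, rfl⟩

theorem toUltra_surjective : Function.Surjective (toUltra hwf) := by
  rintro ⟨_, f, rfl⟩
  exact ⟨f, rfl⟩

theorem ultraClass_transitive : ∀ x ∈ ultraClass hwf, ∀ y ∈ x, y ∈ ultraClass hwf := by
  rintro _ ⟨f, rfl⟩ y hy
  obtain ⟨g, -, rfl⟩ := (mem_coll_iff hwf).1 hy
  exact ⟨g, rfl⟩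

/-- The identification of the ultrapower with `M_W`. -/
def germEquiv : (W : Filter I).Germ ZFSet.{u} ≃ ultraClass hwf :=
  Equiv.ofBijective (fun a => a.liftOn (toUltra hwf)
    fun _ _ h => Subtype.ext (coll_congr hwf h)) <| by
    constructor
    · intro a b
      refine Filter.Germ.inductionOn₂ a b fun f g h => ?_
      exact Filter.Germ.coe_eq.2 ((coll_eq_iff hwf).1 (congrArg Subtype.val h))
    · intro z
      obtain ⟨f, rfl⟩ := toUltra_surjective hwf z
      exact ⟨f, rfl⟩

theorem realize_term_toUltra {α : Type*} (v : α → I → ZFSet.{u}) (t : setLang.Term α) :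
    t.realize (fun a => toUltra hwf (v a)) =
      toUltra hwf fun i => t.realize fun a => v a i := by
  cases t with
  | var a => rfl
  | func f _ => exact f.elim

/-- Łoś's theorem. -/
theorem realize_boundedFormula_toUltra {α : Type*} {n : ℕ} (φ : setLang.BoundedFormula α n)
    (v : α → I → ZFSet.{u}) (xs : Fin n → I → ZFSet.{u}) :
    φ.Realize (fun a => toUltra hwf (v a)) (fun k => toUltra hwf (xs k)) ↔
      ∀ᶠ i in (W : Filter I), φ.Realize (fun a => v a i) fun k => xs k i := by
  have hterm : ∀ {n : ℕ} (xs : Fin n → I → ZFSet.{u}) (t : setLang.Term (α ⊕ Fin n)),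
      t.realize (Sum.elim (fun a => toUltra hwf (v a)) fun k => toUltra hwf (xs k)) =
        toUltra hwf fun i => t.realize (Sum.elim (fun a => v a i) fun k => xs k i) := by
    intro n xs t
    have h1 : (Sum.elim (fun a => toUltra hwf (v a)) fun k => toUltra hwf (xs k)) =
        fun s => toUltra hwf (Sum.elim v xs s) := by
      funext s
      cases s <;> rfl
    have h2 : ∀ i, (Sum.elim (fun a => v a i) fun k => xs k i) =
        fun s => Sum.elim v xs s i := by
      intro i
      funext s
      cases s <;> rfl
    simp only [h1, h2, realize_term_toUltra]
  induction φ with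
  | falsum => simp [Language.BoundedFormula.Realize, W.neBot.ne]
  | equal t₁ t₂ =>
    simp only [Language.BoundedFormula.Realize, hterm]
    rw [Subtype.ext_iff]
    exact coll_eq_iff hwf
  | rel R ts =>
    cases R
    simp only [Language.BoundedFormula.Realize, hterm]
    exact coll_mem_coll_iff hwf
  | imp φ ψ ih₁ ih₂ =>
    simp only [Language.BoundedFormula.Realize, ih₁, ih₂]
    exact Ultrafilter.eventually_imp.symm
  | all φ ih =>
    simp only [Language.BoundedFormula.Realize]
    have hs : ∀ g : I → ZFSet.{u}, Fin.snoc (α := fun _ => ultraClass hwf)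
        (fun k => toUltra hwf (xs k)) (toUltra hwf g) =
          fun k => toUltra hwf (Fin.snoc (α := fun _ => I → ZFSet.{u}) xs g k) := fun g =>
      (Fin.comp_snoc (toUltra hwf) xs g).symm
    have hs' : ∀ (g : I → ZFSet.{u}) (i : I), Fin.snoc (α := fun _ => ZFSet.{u})
        (fun k => xs k i) (g i) = fun k => Fin.snoc (α := fun _ => I → ZFSet.{u}) xs g k i :=
      fun g i => (Fin.comp_snoc (fun h : I → ZFSet.{u} => h i) xs g).symm
    constructor
    · intro h
      by_contra hc
      rw [← Ultrafilter.eventually_not] at hc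
      simp only [not_forall] at hc
      -- Counterexamples chosen pointwise form a function whose class refutes the universal
      -- statement in the ultrapower.
      obtain ⟨g, hg⟩ := hc.choice
      have := h (toUltra hwf g)
      rw [hs] at this
      obtain ⟨i, h1, h2⟩ := (hg.and ((ih _).1 this)).exists
      rw [hs'] at h1
      exact h1 h2
    · intro h z
      obtain ⟨g, rfl⟩ := toUltra_surjective hwf z
      rw [hs]
      refine (ih _).2 ?_
      filter_upwards [h] with i hi
      rw [← hs']
      exact hi _

/-- The ultrapower embedding `j_W`. -/
def ultraEmb : ZFSet.{u} ↪ₑ[setLang] ultraClass hwf where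
  toFun x := toUltra hwf fun _ => x
  map_formula' n φ x := by
    have h := realize_boundedFormula_toUltra hwf φ (fun k _ => x k) Fin.elim0
    have h0 : ∀ i : I, (fun k : Fin 0 => (Fin.elim0 k : I → ZFSet.{u}) i) = default :=
      fun i => Subsingleton.elim _ _
    simp only [h0, Filter.eventually_const] at h
    rw [Subsingleton.elim (fun k : Fin 0 => toUltra hwf (Fin.elim0 k)) default] at h
    rw [Language.Formula.Realize, Language.Formula.Realize]
    convert h using 2
    rfl

theorem ultraEmb_apply (x : ZFSet.{u}) : (ultraEmb hwf x : ZFSet.{u}) = coll hwf fun _ => x := rfl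

theorem isUltrapowerEmbedding_ultraEmb : IsUltrapowerEmbedding W (ultraEmb hwf) :=
  ⟨ultraClass_transitive hwf, germEquiv hwf, fun _ _ => coll_mem_coll_iff hwf, fun _ => rfl⟩

/-! #### Closure of the ultrapower -/

theorem coll_unorderedPair (f g : I → ZFSet.{u}) :
    coll hwf (fun i => {f i, g i}) = {coll hwf f, coll hwf g} := by
  ext z
  rw [mem_coll_iff, ZFSet.mem_pair]
  constructor
  · rintro ⟨k, hk, rfl⟩
    simp only [UMem, ZFSet.mem_pair, Ultrafilter.eventually_or] at hk
    exact hk.imp (coll_congr hwf) (coll_congr hwf)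
  · rintro (rfl | rfl)
    · exact ⟨f, Filter.Eventually.of_forall fun i => by simp, rfl⟩
    · exact ⟨g, Filter.Eventually.of_forall fun i => by simp, rfl⟩

theorem coll_pair (f g : I → ZFSet.{u}) :
    coll hwf (fun i => ZFSet.pair (f i) (g i)) = ZFSet.pair (coll hwf f) (coll hwf g) := by
  have h1 := coll_unorderedPair hwf f f
  simp only [ZFSet.pair_eq_singleton] at h1
  simp only [ZFSet.pair]
  rw [coll_unorderedPair, coll_unorderedPair, h1]

theorem isOrdinal_coll {f : I → ZFSet.{u}}
    (hf : ∀ᶠ i in (W : Filter I), (f i).IsOrdinal) : (coll hwf f).IsOrdinal := by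
  have htrans : ∀ f : I → ZFSet.{u}, (∀ᶠ i in (W : Filter I), (f i).IsOrdinal) →
      (coll hwf f).IsTransitive := fun f hf => by
    intro y hy z hz
    obtain ⟨g, hg, rfl⟩ := (mem_coll_iff hwf).1 hy
    obtain ⟨k, hk, rfl⟩ := (mem_coll_iff hwf).1 hz
    rw [coll_mem_coll_iff]
    filter_upwards [hf, hg, hk] with i h1 h2 h3
    exact h1.mem_trans h3 h2
  rw [ZFSet.isOrdinal_iff_forall_mem_isTransitive]
  refine ⟨htrans f hf, fun y hy => ?_⟩
  obtain ⟨g, hg, rfl⟩ := (mem_coll_iff hwf).1 hy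
  refine htrans g ?_
  filter_upwards [hf, hg] with i h1 h2
  exact h1.mem h2

variable {κ : Cardinal.{u}}

/-- The von Neumann ordinal of a point of `κ`. -/
def Pt.code (a : Pt κ) : ZFSet.{u} := (a.toOrd : Ordinal.{u}).toZFSet

theorem Pt.code_injective : Function.Injective (Pt.code (κ := κ)) := fun a b h => by
  exact ToType.mk.symm.injective (Subtype.ext (Ordinal.toZFSet_injective h))

theorem Pt.code_mem_code_iff {a b : Pt κ} : a.code ∈ b.code ↔ a < b := by
  rw [Pt.code, Pt.code, Ordinal.toZFSet_mem_toZFSet_iff]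
  simp

theorem Pt.exists_code {x : ZFSet.{u}} : x ∈ κ.ord.toZFSet ↔ ∃ a : Pt κ, a.code = x := by
  rw [Ordinal.mem_toZFSet_iff]
  constructor
  · rintro ⟨ξ, hξ, rfl⟩
    exact ⟨ToType.mk ⟨ξ, hξ⟩, by simp [Pt.code]⟩
  · rintro ⟨a, rfl⟩
    exact ⟨a.toOrd, a.toOrd.2, rfl⟩

theorem Pt.exists_code_mem {a : Pt κ} {x : ZFSet.{u}} :
    x ∈ a.code ↔ ∃ b : Pt κ, b < a ∧ b.code = x := by
  constructor
  · intro h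
    have : x ∈ κ.ord.toZFSet :=
      (ZFSet.isOrdinal_toZFSet _).mem_trans h (Pt.exists_code.2 ⟨a, rfl⟩)
    obtain ⟨b, rfl⟩ := Pt.exists_code.1 this
    exact ⟨b, Pt.code_mem_code_iff.1 h, rfl⟩
  · rintro ⟨b, hb, rfl⟩
    exact Pt.code_mem_code_iff.2 hb

theorem mem_subsetCode {X : Set (Pt κ)} {x : ZFSet.{u}} :
    x ∈ subsetCode X ↔ ∃ a ∈ X, a.code = x := by
  simp [subsetCode, Pt.code]

theorem code_mem_subsetCode {X : Set (Pt κ)} {a : Pt κ} : a.code ∈ subsetCode X ↔ a ∈ X := by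
  rw [mem_subsetCode]
  exact ⟨fun ⟨b, hb, h⟩ => Pt.code_injective h ▸ hb, fun h => ⟨a, h, rfl⟩⟩

theorem exists_isSeed (U : Ultrafilter (Pt κ)) (f : I → Pt κ) (hf : W.map f = U) :
    IsSeed (ultraEmb hwf) (coll hwf fun i => (f i).code).rank U ∧
      (coll hwf fun i => (f i).code).rank.toZFSet = coll hwf fun i => (f i).code := by
  have h : (coll hwf fun i => (f i).code).rank.toZFSet = coll hwf fun i => (f i).code :=
    (isOrdinal_coll hwf
      (Filter.Eventually.of_forall fun i => ZFSet.isOrdinal_toZFSet _)).toZFSet_rank_eq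
  refine ⟨fun X => ?_, h⟩
  rw [h, ultraEmb_apply, coll_mem_coll_iff, ← hf]
  simp only [UMem, code_mem_subsetCode]
  rfl

/-- A function with values in a fixed set of size below `κ` is constant on a large set, so `j_W`
adds no new elements to ordinals below `κ`. -/
theorem ultraEmb_code (hW : IsComplete κ W) (a : Pt κ) :
    (ultraEmb hwf a.code : ZFSet.{u}) = a.code := by
  induction a using WellFoundedLT.induction with
  | ind a ih =>
  rw [ultraEmb_apply]
  ext z
  rw [mem_coll_iff, Pt.exists_code_mem]
  constructor
  · rintro ⟨g, hg, rfl⟩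
    have : ∀ᶠ i in (W : Filter I), ∃ b : Set.Iio a, g i = b.1.code := by
      filter_upwards [hg] with i hi
      obtain ⟨b, hb, h⟩ := Pt.exists_code_mem.1 hi
      exact ⟨⟨b, hb⟩, h.symm⟩
    obtain ⟨b, hb⟩ := hW.exists_eventually (mk_Iio_pt_lt a) this
    exact ⟨b, b.2, by rw [← ih b b.2]; exact (coll_congr hwf hb).symm⟩
  · rintro ⟨b, hb, rfl⟩
    exact ⟨fun _ => b.code, Filter.Eventually.of_forall fun i => Pt.code_mem_code_iff.2 hb,
      ih b hb⟩

/-- `W` is not concentrated on a single fibre of `g : I → κ`. -/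
def NonConst (W : Ultrafilter I) (g : I → Pt κ) : Prop :=
  ∀ a, ¬ ∀ᶠ i in (W : Filter I), g i = a

theorem ultraEmb_kappa_ne (hW : IsComplete κ W) {g : I → Pt κ} (hg : NonConst W g) :
    (ultraEmb hwf κ.ord.toZFSet : ZFSet.{u}) ≠ κ.ord.toZFSet := by
  intro h
  have : coll hwf (fun i => (g i).code) ∈ (ultraEmb hwf κ.ord.toZFSet : ZFSet.{u}) := by
    rw [ultraEmb_apply, coll_mem_coll_iff]
    exact Filter.Eventually.of_forall fun i => Pt.exists_code.2 ⟨_, rfl⟩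
  rw [h] at this
  obtain ⟨a, ha⟩ := Pt.exists_code.1 this
  rw [← ultraEmb_code hwf hW, ultraEmb_apply, coll_eq_iff] at ha
  exact hg a (ha.mono fun i hi => (Pt.code_injective hi).symm)

/-- A least non-constant function `I → κ` represents `κ`. -/
theorem exists_minimal_nonConst (hκ : ℵ₀ < κ) (hW : IsComplete κ W) {g : I → Pt κ}
    (hg : NonConst W g) : ∃ g : I → Pt κ,
      (∀ a, ∀ᶠ i in (W : Filter I), a < g i) ∧
      ∀ h : I → Pt κ, (∀ᶠ i in (W : Filter I), h i < g i) →
        ∃ a, ∀ᶠ i in (W : Filter I), h i = a := by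
  obtain ⟨g, hg, hmin⟩ := (hW.wellFounded hκ (wellFounded_lt (α := Pt κ))).has_min
    {g | NonConst W g} ⟨g, hg⟩
  refine ⟨g, fun a => ?_, fun h hh => ?_⟩
  · by_contra hc
    have : ∀ᶠ i in (W : Filter I), ∃ b : Set.Iic a, g i = (b : Pt κ) := by
      filter_upwards [Ultrafilter.eventually_not.2 hc] with i hi
      exact ⟨⟨g i, not_lt.1 hi⟩, rfl⟩
    obtain ⟨b, hb⟩ := hW.exists_eventually (mk_Iic_lt hκ a) this
    exact hg b hb
  · by_contra! hc
    exact hmin h (fun a => Ultrafilter.eventually_not.1 (hc a)) hh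

/-- If `g` represents `κ` and `h a` represents the value at `a`, the function sending `i` to the
sequence `⟨h a i | a < g i⟩` represents the whole `κ`-sequence: by minimality of `g`, any index
chosen below `g i` is constant modulo `W`. -/
theorem ultraClass_closed (hκ : ℵ₀ < κ) (hW : IsComplete κ W) {g : I → Pt κ}
    (hg : NonConst W g) (f y : ZFSet.{u}) (hf : ZFSet.IsFunc κ.ord.toZFSet y f)
    (hy : ∀ z ∈ y, z ∈ ultraClass hwf) : f ∈ ultraClass hwf := by
  obtain ⟨g, hg1, hg2⟩ := exists_minimal_nonConst hκ hW hg
  have hval : ∀ a : Pt κ, ∃ h : I → ZFSet.{u}, ∀ w, ZFSet.pair a.code w ∈ f ↔ w = coll hwf h := by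
    intro a
    obtain ⟨w, hw, hw'⟩ := hf.2 a.code (Pt.exists_code.2 ⟨a, rfl⟩)
    obtain ⟨h, rfl⟩ := hy w (ZFSet.pair_mem_prod.1 (hf.1 hw)).2
    exact ⟨h, fun w' => ⟨fun h' => hw' w' h', fun h' => h' ▸ hw⟩⟩
  choose h hh using hval
  refine ⟨fun i => ZFSet.range fun a : Set.Iio (g i) => ZFSet.pair a.1.code (h a.1 i), ?_⟩
  ext z
  rw [mem_coll_iff]
  constructor
  · rintro ⟨k, hk, rfl⟩
    have : ∀ᶠ i in (W : Filter I), ∃ a : Pt κ, a < g i ∧ k i = ZFSet.pair a.code (h a i) := by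
      filter_upwards [hk] with i hi
      obtain ⟨a, ha⟩ := ZFSet.mem_range.1 hi
      exact ⟨a.1, a.2, ha.symm⟩
    obtain ⟨a, ha⟩ := this.choice
    obtain ⟨b, hb⟩ := hg2 a (ha.mono fun i hi => hi.1)
    have : coll hwf k = ZFSet.pair b.code (coll hwf (h b)) := by
      rw [← ultraEmb_code hwf hW b, ultraEmb_apply, ← coll_pair, coll_eq_iff]
      filter_upwards [ha, hb] with i h1 h2
      rw [h1.2, h2]
    rw [this, hh]
  · intro hz
    obtain ⟨p, hp, w, hw, rfl⟩ := ZFSet.mem_prod.1 (hf.1 hz)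
    obtain ⟨a, rfl⟩ := Pt.exists_code.1 hp
    rw [(hh a w).1 hz]
    refine ⟨fun i => ZFSet.pair a.code (h a i), ?_, ?_⟩
    · filter_upwards [hg1 a] with i hi
      exact ZFSet.mem_range.2 ⟨⟨a, hi⟩, rfl⟩
    · rw [coll_pair, ← ultraEmb_apply, ultraEmb_code hwf hW]

end Ultrapower

/-! ### Formulas of set theory with named variables -/

section Formulas

open Language

/-- The membership symbol. -/
def memRel : setLang.Relations 2 := SetRel.mem

/-- The formula `xᵢ ∈ xⱼ`. -/
def memF (i j : ℕ) : setLang.Formula ℕ :=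
  Relations.formula₂ memRel (Term.var i) (Term.var j)

/-- The formula `xᵢ = xⱼ`. -/
def eqF (i j : ℕ) : setLang.Formula ℕ := Term.equal (Term.var i) (Term.var j)

/-- The formula `∀ xᵢ, φ`. -/
def allF (i : ℕ) (φ : setLang.Formula ℕ) : setLang.Formula ℕ :=
  Formula.iAlls Unit (φ.relabel fun k => if k = i then Sum.inr () else Sum.inl k)

/-- The formula `∃ xᵢ, φ`. -/
def exF (i : ℕ) (φ : setLang.Formula ℕ) : setLang.Formula ℕ :=
  Formula.iExs Unit (φ.relabel fun k => if k = i then Sum.inr () else Sum.inl k)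

theorem relabel_sum_elim {N : Type*} (i : ℕ) (v : ℕ → N) (x : Unit → N) :
    ((fun a => Sum.elim v x a) ∘ fun k => if k = i then Sum.inr () else Sum.inl k) =
      Function.update v i (x ()) := by
  funext k
  by_cases hk : k = i
  · subst hk
    simp
  · simp [hk]

/-- A structure for the language of set theory isomorphic, by `emb`, to a transitive class. -/
class TransModel (N : Type (u + 1)) [setLang.Structure N] where
  /-- The isomorphism with a transitive class. -/
  emb : N → ZFSet.{u}
  injective : Function.Injective emb
  relMap_iff : ∀ x : Fin 2 → N,
    Structure.RelMap memRel x ↔ emb (x 0) ∈ emb (x 1)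
  transitive : ∀ x, ∀ y ∈ emb x, ∃ z, emb z = y

instance transModelV : TransModel ZFSet.{u} where
  emb := id
  injective := Function.injective_id
  relMap_iff _ := Iff.rfl
  transitive _ y _ := ⟨y, rfl⟩

/-- A transitive class as a model. -/
@[reducible]
def transModelClass {M : Set ZFSet.{u}} (hM : ∀ x ∈ M, ∀ y ∈ x, y ∈ M) : TransModel M where
  emb := Subtype.val
  injective := Subtype.val_injective
  relMap_iff _ := Iff.rfl
  transitive x y hy := ⟨⟨y, hM x x.2 y hy⟩, rfl⟩

variable {N : Type (u + 1)} [setLang.Structure N]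

@[simp] theorem realize_allF {i : ℕ} {φ : setLang.Formula ℕ} {v : ℕ → N} :
    (allF i φ).Realize v ↔ ∀ x, φ.Realize (Function.update v i x) := by
  rw [allF, Formula.realize_iAlls]
  simp only [Formula.realize_relabel, relabel_sum_elim]
  exact ⟨fun h x => h fun _ => x, fun h x => h (x ())⟩

@[simp] theorem realize_exF {i : ℕ} {φ : setLang.Formula ℕ} {v : ℕ → N} :
    (exF i φ).Realize v ↔ ∃ x, φ.Realize (Function.update v i x) := by
  rw [exF, Formula.realize_iExs]
  simp only [Formula.realize_relabel, relabel_sum_elim]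
  exact ⟨fun ⟨x, h⟩ => ⟨x (), h⟩, fun ⟨x, h⟩ => ⟨fun _ => x, h⟩⟩

@[simp] theorem realize_eqF {i j : ℕ} {v : ℕ → N} : (eqF i j).Realize v ↔ v i = v j := by
  simp [eqF, Formula.realize_equal]

section TransModel

variable [TransModel N]

open TransModel (emb)

@[simp] theorem realize_memF {i j : ℕ} {v : ℕ → N} :
    (memF i j).Realize v ↔ emb (v i) ∈ emb (v j) := by
  rw [memF, Formula.realize_rel₂, TransModel.relMap_iff]
  simp

/-- The formula `xₛ = {xₐ, x_b}`. -/
def upairF (s a b : ℕ) : setLang.Formula ℕ :=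
  -- This index exceeds `s`, `a` and `b`, so the bound variable captures none of them.
  allF (s + a + b + 1)
    ((memF (s + a + b + 1) s).iff (eqF (s + a + b + 1) a ⊔ eqF (s + a + b + 1) b))

@[simp] theorem realize_upairF {s a b : ℕ} {v : ℕ → N} :
    (upairF s a b).Realize v ↔ emb (v s) = {emb (v a), emb (v b)} := by
  have h1 : s ≠ s + a + b + 1 := by omega
  have h2 : a ≠ s + a + b + 1 := by omega
  have h3 : b ≠ s + a + b + 1 := by omega
  simp only [upairF, realize_allF, Formula.realize_iff, realize_memF, Formula.realize_sup,
    realize_eqF, Function.update_self, Function.update_of_ne h1, Function.update_of_ne h2,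
    Function.update_of_ne h3]
  constructor
  · intro h
    ext z
    rw [ZFSet.mem_pair]
    constructor
    · intro hz
      obtain ⟨z, rfl⟩ := TransModel.transitive _ z hz
      exact ((h z).1 hz).imp (congrArg _) (congrArg _)
    · rintro (rfl | rfl)
      · exact (h _).2 (Or.inl rfl)
      · exact (h _).2 (Or.inr rfl)
  · intro h z
    rw [h, ZFSet.mem_pair, TransModel.injective.eq_iff, TransModel.injective.eq_iff]

/-- The formula `xₚ = ⟨xₐ, x_b⟩`. -/
def pairF (p a b : ℕ) : setLang.Formula ℕ :=
  exF (p + a + b + 1) (memF (p + a + b + 1) p ⊓ upairF (p + a + b + 1) a a) ⊓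
  (exF (p + a + b + 1) (memF (p + a + b + 1) p ⊓ upairF (p + a + b + 1) a b) ⊓
  allF (p + a + b + 1) (memF (p + a + b + 1) p ⟹
    (upairF (p + a + b + 1) a a ⊔ upairF (p + a + b + 1) a b)))

@[simp] theorem realize_pairF {p a b : ℕ} {v : ℕ → N} :
    (pairF p a b).Realize v ↔ emb (v p) = ZFSet.pair (emb (v a)) (emb (v b)) := by
  have h1 : p ≠ p + a + b + 1 := by omega
  have h2 : a ≠ p + a + b + 1 := by omega
  have h3 : b ≠ p + a + b + 1 := by omega
  simp only [pairF, realize_allF, realize_exF, Formula.realize_inf, realize_memF,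
    Formula.realize_sup, Formula.realize_imp, realize_upairF,
    Function.update_self, Function.update_of_ne h1, Function.update_of_ne h2,
    Function.update_of_ne h3]
  constructor
  · rintro ⟨⟨s, hs, hs'⟩, ⟨t, ht, ht'⟩, h⟩
    ext z
    rw [ZFSet.pair, ZFSet.mem_pair, ← ZFSet.pair_eq_singleton]
    constructor
    · intro hz
      obtain ⟨z, rfl⟩ := TransModel.transitive _ z hz
      exact h z hz
    · rintro (rfl | rfl)
      · rwa [← hs']
      · rwa [← ht']
  · intro h
    have e : emb (v p) = {{emb (v a), emb (v a)}, {emb (v a), emb (v b)}} := by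
      rw [h, ZFSet.pair, ZFSet.pair_eq_singleton (emb (v a))]
    simp only [e, ZFSet.mem_pair]
    obtain ⟨s, hs⟩ := TransModel.transitive (v p) {emb (v a), emb (v a)}
      (by simp [h, ZFSet.pair])
    obtain ⟨t, ht⟩ := TransModel.transitive (v p) {emb (v a), emb (v b)}
      (by simp [h, ZFSet.pair])
    exact ⟨⟨s, Or.inl hs, hs⟩, ⟨t, Or.inr ht, ht⟩, fun _ h => h⟩

/-- The formula `⟨xₐ, x_b⟩ ∈ x_g`. -/
def pmemF (a b g : ℕ) : setLang.Formula ℕ :=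
  exF (a + b + g + 1) (memF (a + b + g + 1) g ⊓ pairF (a + b + g + 1) a b)

@[simp] theorem realize_pmemF {a b g : ℕ} {v : ℕ → N} :
    (pmemF a b g).Realize v ↔ ZFSet.pair (emb (v a)) (emb (v b)) ∈ emb (v g) := by
  have h1 : g ≠ a + b + g + 1 := by omega
  have h2 : a ≠ a + b + g + 1 := by omega
  have h3 : b ≠ a + b + g + 1 := by omega
  simp only [pmemF, realize_exF, Formula.realize_inf, realize_memF, realize_pairF,
    Function.update_self, Function.update_of_ne h1, Function.update_of_ne h2,
    Function.update_of_ne h3]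
  constructor
  · rintro ⟨p, hp, h⟩
    rwa [← h]
  · intro h
    obtain ⟨p, hp⟩ := TransModel.transitive _ _ h
    exact ⟨p, hp ▸ h, hp⟩

end TransModel

@[simp] theorem emb_V (x : ZFSet.{u}) : TransModel.emb x = x := rfl

end Formulas

/-! ### Definability of the ultrapower embedding -/

section Definability

open Language

/-- The formula saying that `x_g` is a function on `x₃`. -/
def funF (g : ℕ) : setLang.Formula ℕ :=
  allF 9 (memF 9 3 ⟹ exF 10 (allF 11 ((pmemF 9 11 g).iff (eqF 11 10))))

/-- The formula saying that `x_g` is below `x_h` modulo the ultrafilter `x₂`. -/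
def umemF (g h : ℕ) : setLang.Formula ℕ :=
  exF 12 (memF 12 2 ⊓ allF 9 (memF 9 12 ⟹
    exF 10 (exF 11 (pmemF 9 10 g ⊓ (pmemF 9 11 h ⊓ memF 10 11)))))

/-- The formula saying that `x_g` and `x_h` agree modulo the ultrafilter `x₂`. -/
def ueqF (g h : ℕ) : setLang.Formula ℕ :=
  exF 12 (memF 12 2 ⊓ allF 9 (memF 9 12 ⟹ exF 10 (pmemF 9 10 g ⊓ pmemF 9 10 h)))

/-- The formula saying that `x₄` is a partial collapse of the ultrapower by `x₂`. -/
def partialCollapseF : setLang.Formula ℕ :=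
  -- Variables 0 and 1 are kept for argument and value of the embedding, 2 for the code of `W`, 3
  -- for the code of the index set, 4 for the partial collapse. The auxiliary formulas bind only 9
  -- to 12, besides the fresh variables inside `pmemF`.
  allF 5 (allF 6 (pmemF 5 6 4 ⟹ (funF 5 ⊓
    (allF 7 ((memF 7 6).iff (exF 8 (umemF 8 5 ⊓ pmemF 8 7 4))) ⊓
    allF 8 (funF 8 ⟹ (umemF 8 5 ⟹ exF 13 (exF 7 (ueqF 8 13 ⊓ pmemF 13 7 4))))))))

/-- The formula defining the ultrapower embedding. -/
def ultraEmbF : setLang.Formula ℕ :=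
  exF 4 (partialCollapseF ⊓
    exF 5 (allF 9 (memF 9 3 ⟹ pmemF 9 0 5) ⊓ (funF 5 ⊓ pmemF 5 1 4)))

variable {I : Type u} (W : Ultrafilter I) (enc : I → ZFSet.{u})

/-- The set coding the ultrafilter `W`. -/
def ultraCode : ZFSet.{u} :=
  ZFSet.range fun X : {X : Set I // X ∈ W} => ZFSet.range fun i : X.1 => enc i

/-- The set `g` is the graph of `h : I → V`. -/
def Dec (g : ZFSet.{u}) (h : I → ZFSet.{u}) : Prop :=
  ∀ i a, ZFSet.pair (enc i) a ∈ g ↔ a = h i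

variable {W enc}

theorem exists_dec_iff {g : ZFSet.{u}} : (∃ h, Dec enc g h) ↔
    ∀ i ∈ ZFSet.range enc, ∃ a, ∀ b, ZFSet.pair i b ∈ g ↔ b = a := by
  simp only [ZFSet.mem_range, forall_exists_index, forall_apply_eq_imp_iff, Dec]
  exact (Classical.skolem (p := fun i a => ∀ b, ZFSet.pair (enc i) b ∈ g ↔ b = a)).symm

theorem exists_ultraCode_iff {P : ZFSet.{u} → Prop} :
    (∃ X ∈ ultraCode W enc, ∀ i ∈ X, P i) ↔ ∀ᶠ i in (W : Filter I), P (enc i) := by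
  simp only [ultraCode, ZFSet.mem_range]
  constructor
  · rintro ⟨_, ⟨X, rfl⟩, h⟩
    filter_upwards [X.2] with i hi
    exact h _ (ZFSet.mem_range.2 ⟨⟨i, hi⟩, rfl⟩)
  · intro h
    refine ⟨_, ⟨⟨{i | P (enc i)}, h⟩, rfl⟩, fun i hi => ?_⟩
    obtain ⟨i, rfl⟩ := ZFSet.mem_range.1 hi
    exact i.2

/-- The graph of `h : I → V`. -/
def graph (enc : I → ZFSet.{u}) (h : I → ZFSet.{u}) : ZFSet.{u} :=
  ZFSet.range fun i => ZFSet.pair (enc i) (h i)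

theorem dec_graph (henc : Function.Injective enc) (h : I → ZFSet.{u}) :
    Dec enc (graph enc h) h := by
  intro i a
  simp only [graph, ZFSet.mem_range, ZFSet.pair_inj]
  constructor
  · rintro ⟨k, hk, rfl⟩
    rw [henc hk]
  · rintro rfl
    exact ⟨i, rfl, rfl⟩

theorem Dec.unique {g : ZFSet.{u}} {h h' : I → ZFSet.{u}} (hg : Dec enc g h)
    (hg' : Dec enc g h') : h = h' :=
  funext fun i => (hg' i (h i)).1 ((hg i (h i)).2 rfl)

theorem Dec.umem_iff {g g' : ZFSet.{u}} {h h' : I → ZFSet.{u}} (hg : Dec enc g h)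
    (hg' : Dec enc g' h') :
    (∃ X ∈ ultraCode W enc, ∀ i ∈ X, ∃ a b, ZFSet.pair i a ∈ g ∧ ZFSet.pair i b ∈ g' ∧ a ∈ b) ↔
      UMem W h h' := by
  rw [exists_ultraCode_iff]
  simp only [hg _, hg' _, exists_eq_left, ↓existsAndEq, true_and]

theorem Dec.ueq_iff {g g' : ZFSet.{u}} {h h' : I → ZFSet.{u}} (hg : Dec enc g h)
    (hg' : Dec enc g' h') :
    (∃ X ∈ ultraCode W enc, ∀ i ∈ X, ∃ a, ZFSet.pair i a ∈ g ∧ ZFSet.pair i a ∈ g') ↔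
      h =ᶠ[(W : Filter I)] h' := by
  rw [exists_ultraCode_iff]
  simp only [hg _, hg' _, exists_eq_left]
  rfl

variable (W enc) in
/-- The set `p` of pairs is a partial collapse of the ultrapower by `W`. -/
def PartialCollapse (p : ZFSet.{u}) : Prop :=
  ∀ g w, ZFSet.pair g w ∈ p → ∃ h, Dec enc g h ∧
    (∀ z, z ∈ w ↔ ∃ g' h', Dec enc g' h' ∧ UMem W h' h ∧ ZFSet.pair g' z ∈ p) ∧
    ∀ h', UMem W h' h → ∃ g' h'' z, Dec enc g' h'' ∧ h' =ᶠ[(W : Filter I)] h'' ∧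
      ZFSet.pair g' z ∈ p

/-- Induction along the ultrapower membership relation: the clauses for a partial collapse are the
recursion equation of `coll`, with the domain closed under `W`-members up to equality modulo `W`. So
the value read from any partial collapse is the true one. -/
theorem PartialCollapse.eq_coll (hwf : WellFounded (UMem W)) {p : ZFSet.{u}}
    (hp : PartialCollapse W enc p) {h : I → ZFSet.{u}} {g w : ZFSet.{u}}
    (hgw : ZFSet.pair g w ∈ p) (hg : Dec enc g h) : w = coll hwf h := by
  induction h using hwf.induction generalizing g w with
  | _ h ih =>
  obtain ⟨h₀, hg₀, hw, hex⟩ := hp g w hgw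
  obtain rfl := hg.unique hg₀
  ext z
  rw [hw, mem_coll_iff]
  constructor
  · rintro ⟨g', h', hg', hlt, hz⟩
    exact ⟨h', hlt, (ih h' hlt hz hg').symm⟩
  · rintro ⟨h', hlt, rfl⟩
    obtain ⟨g', h'', z, hg', heq, hz⟩ := hex h' hlt
    have hlt' : UMem W h'' h := by
      filter_upwards [heq, hlt] with i h1 h2
      rwa [← h1]
    refine ⟨g', h'', hg', hlt', ?_⟩
    rwa [coll_congr hwf heq, ← ih h'' hlt' hz hg']

open Classical in
theorem exists_partialCollapse (hwf : WellFounded (UMem W)) (henc : Function.Injective enc)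
    (x : ZFSet.{u}) : ∃ p, PartialCollapse W enc p ∧
      ZFSet.pair (graph enc fun _ => x) (coll hwf fun _ => x) ∈ p := by
  -- Transitivity of `T` makes the set of functions `I → T` closed, up to equality modulo `W`, under
  -- `W`-members, so the collapse restricted to it is a set.
  obtain ⟨T, hT, hx⟩ : ∃ T : ZFSet.{u}, T.IsTransitive ∧ x ∈ T :=
    ⟨_, ZFSet.isTransitive_vonNeumann _, ZFSet.mem_vonNeumann_succ x⟩
  let p := ZFSet.range fun h : I → T =>
    ZFSet.pair (graph enc fun i => (h i).1) (coll hwf fun i => (h i).1)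
  have hmem : ∀ g w, ZFSet.pair g w ∈ p ↔
      ∃ h : I → ZFSet.{u}, (∀ i, h i ∈ T) ∧ g = graph enc h ∧ w = coll hwf h := by
    intro g w
    simp only [p, ZFSet.mem_range, ZFSet.pair_inj]
    constructor
    · rintro ⟨h, rfl, rfl⟩
      exact ⟨_, fun i => (h i).2, rfl, rfl⟩
    · rintro ⟨h, hh, rfl, rfl⟩
      exact ⟨fun i => ⟨h i, hh i⟩, rfl, rfl⟩
  have hrestrict : ∀ k h : I → ZFSet.{u}, (∀ i, h i ∈ T) → UMem W k h →
      ∃ k' : I → ZFSet.{u}, (∀ i, k' i ∈ T) ∧ k =ᶠ[(W : Filter I)] k' := by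
    intro k h hh hk
    refine ⟨fun i => if k i ∈ h i then k i else x, fun i => ?_, ?_⟩
    · change (if k i ∈ h i then k i else x) ∈ T
      split_ifs with hi
      · exact hT.mem_trans hi (hh i)
      · exact hx
    · filter_upwards [hk] with i hi
      rw [if_pos hi]
  refine ⟨p, fun g w hgw => ?_, (hmem _ _).2 ⟨_, fun _ => hx, rfl, rfl⟩⟩
  obtain ⟨h, hh, rfl, rfl⟩ := (hmem _ _).1 hgw
  refine ⟨h, dec_graph henc h, fun z => ?_, fun h' hlt => ?_⟩
  · rw [mem_coll_iff]
    constructor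
    · rintro ⟨k, hk, rfl⟩
      obtain ⟨k', hk', heq⟩ := hrestrict k h hh hk
      refine ⟨graph enc k', k', dec_graph henc k', ?_,
        (hmem _ _).2 ⟨k', hk', rfl, coll_congr hwf heq⟩⟩
      filter_upwards [heq, hk] with i h1 h2
      rwa [← h1]
    · rintro ⟨g', h', hg', hlt, hz⟩
      obtain ⟨k, hk, rfl, rfl⟩ := (hmem _ _).1 hz
      obtain rfl := hg'.unique (dec_graph henc k)
      exact ⟨h', hlt, rfl⟩
  · obtain ⟨k', hk', heq⟩ := hrestrict h' h hh hlt
    exact ⟨graph enc k', k', coll hwf k', dec_graph henc k', heq, (hmem _ _).2 ⟨k', hk', rfl, rfl⟩⟩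

theorem realize_funF {g : ℕ} (hg : g < 9) {v : ℕ → ZFSet.{u}} (hv : v 3 = ZFSet.range enc) :
    (funF g).Realize v ↔ ∃ h, Dec enc (v g) h := by
  rw [exists_dec_iff]
  have h1 : g ≠ 9 := by omega
  have h2 : g ≠ 10 := by omega
  have h3 : g ≠ 11 := by omega
  simp [funF, h1, h2, h3, hv, Formula.realize_imp, Formula.realize_iff]

theorem realize_umemF {g h : ℕ} (hg : g < 9) (hh : h < 9) {v : ℕ → ZFSet.{u}}
    (hv : v 2 = ultraCode W enc) {k l : I → ZFSet.{u}} (hk : Dec enc (v g) k)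
    (hl : Dec enc (v h) l) : (umemF g h).Realize v ↔ UMem W k l := by
  rw [← hk.umem_iff hl]
  have h1 : g ≠ 9 := by omega
  have h2 : g ≠ 10 := by omega
  have h3 : g ≠ 11 := by omega
  have h4 : g ≠ 12 := by omega
  have h1' : h ≠ 9 := by omega
  have h2' : h ≠ 10 := by omega
  have h3' : h ≠ 11 := by omega
  have h4' : h ≠ 12 := by omega
  simp [umemF, h1, h2, h3, h4, h1', h2', h3', h4', hv,
    Formula.realize_imp, Formula.realize_inf]

theorem realize_ueqF {v : ℕ → ZFSet.{u}}
    (hv : v 2 = ultraCode W enc) {k l : I → ZFSet.{u}} (hk : Dec enc (v 8) k)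
    (hl : Dec enc (v 13) l) : (ueqF 8 13).Realize v ↔ k =ᶠ[(W : Filter I)] l := by
  rw [← hk.ueq_iff hl]
  simp [ueqF, hv, Formula.realize_imp, Formula.realize_inf]

theorem realize_partialCollapseF (henc : Function.Injective enc) {v : ℕ → ZFSet.{u}}
    (hv : v 2 = ultraCode W enc) (hv' : v 3 = ZFSet.range enc) :
    partialCollapseF.Realize v ↔ PartialCollapse W enc (v 4) := by
  simp only [partialCollapseF, realize_allF, realize_exF, Formula.realize_imp,
    Formula.realize_inf, Formula.realize_iff, realize_pmemF, realize_memF, emb_V]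
  have hfun : ∀ g w, (funF 5).Realize (Function.update (Function.update v 5 g) 6 w) ↔
      ∃ h, Dec enc g h := fun g w => by
    rw [realize_funF (enc := enc) (by norm_num) (by simp [hv'])]
    simp
  have hfun' : ∀ g w g', (funF 8).Realize (Function.update (Function.update
      (Function.update v 5 g) 6 w) 8 g') ↔ ∃ h, Dec enc g' h := fun g w g' => by
    rw [realize_funF (enc := enc) (by norm_num) (by simp [hv'])]
    simp
  have hmem : ∀ g w z g' h h', Dec enc g h → Dec enc g' h' →
      ((umemF 8 5).Realize (Function.update (Function.update (Function.update
        (Function.update v 5 g) 6 w) 7 z) 8 g') ↔ UMem W h' h) :=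
    fun g w z g' h h' hg hg' => realize_umemF (enc := enc) (by norm_num) (by norm_num) (by simp [hv])
      (by simpa using hg') (by simpa using hg)
  have hmem' : ∀ g w g' h h', Dec enc g h → Dec enc g' h' →
      ((umemF 8 5).Realize (Function.update (Function.update
        (Function.update v 5 g) 6 w) 8 g') ↔ UMem W h' h) :=
    fun g w g' h h' hg hg' => realize_umemF (enc := enc) (by norm_num) (by norm_num) (by simp [hv])
      (by simpa using hg') (by simpa using hg)
  have heq : ∀ g w g' k z h h', Dec enc g' h → Dec enc k h' →
      ((ueqF 8 13).Realize (Function.update (Function.update (Function.update (Function.update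
        (Function.update v 5 g) 6 w) 8 g') 13 k) 7 z) ↔ h =ᶠ[(W : Filter I)] h') :=
    fun g w g' k z h h' hg hg' => realize_ueqF (enc := enc) (by simp [hv])
      (by simpa using hg) (by simpa using hg')
  simp only [hfun, hfun']
  simp only [Function.update_self, ne_eq, Nat.reduceEqDiff,
    not_false_eq_true, Function.update_of_ne]
  constructor
  · intro H g w hgw
    obtain ⟨⟨h, hg⟩, h2, h3⟩ := H g w hgw
    refine ⟨h, hg, fun z => ?_, fun h' hlt => ?_⟩
    · rw [h2]
      refine exists_congr fun g' => ?_
      constructor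
      · rintro ⟨hlt, hz⟩
        obtain ⟨⟨h', hg'⟩, -⟩ := H g' z hz
        exact ⟨h', hg', (hmem _ _ _ _ _ _ hg hg').1 hlt, hz⟩
      · rintro ⟨h', hg', hlt, hz⟩
        exact ⟨(hmem _ _ _ _ _ _ hg hg').2 hlt, hz⟩
    · have hg' := dec_graph henc h'
      obtain ⟨k, z, hk, hz⟩ := h3 _ ⟨h', hg'⟩ ((hmem' _ _ _ _ _ hg hg').2 hlt)
      obtain ⟨⟨h'', hk'⟩, -⟩ := H k z hz
      exact ⟨k, h'', z, hk', (heq _ _ _ _ _ _ _ hg' hk').1 hk, hz⟩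
  · intro H g w hgw
    obtain ⟨h, hg, h2, h3⟩ := H g w hgw
    refine ⟨⟨h, hg⟩, fun z => ?_, ?_⟩
    · rw [h2]
      refine exists_congr fun g' => ?_
      constructor
      · rintro ⟨h', hg', hlt, hz⟩
        exact ⟨(hmem _ _ _ _ _ _ hg hg').2 hlt, hz⟩
      · rintro ⟨hlt, hz⟩
        obtain ⟨h', hg', -⟩ := H g' z hz
        exact ⟨h', hg', (hmem _ _ _ _ _ _ hg hg').1 hlt, hz⟩
    · rintro g' ⟨h', hg'⟩ hlt
      obtain ⟨k, h'', z, hk, hkeq, hz⟩ := h3 h' ((hmem' _ _ _ _ _ hg hg').1 hlt)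
      exact ⟨k, z, (heq _ _ _ _ _ _ _ hg' hk).2 hkeq, hz⟩

theorem realize_ultraEmbF (hwf : WellFounded (UMem W)) (henc : Function.Injective enc)
    {v : ℕ → ZFSet.{u}} (hv : v 2 = ultraCode W enc) (hv' : v 3 = ZFSet.range enc) :
    ultraEmbF.Realize v ↔ coll hwf (fun _ => v 0) = v 1 := by
  simp only [ultraEmbF, realize_allF, realize_exF, Formula.realize_imp,
    Formula.realize_inf, realize_pmemF, realize_memF, emb_V]
  have hp : ∀ p, partialCollapseF.Realize (Function.update v 4 p) ↔ PartialCollapse W enc p :=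
    fun p => by
      rw [realize_partialCollapseF henc (W := W) (by simp [hv]) (by simp [hv'])]
      simp
  have hfun : ∀ p g, (funF 5).Realize (Function.update (Function.update v 4 p) 5 g) ↔
      ∃ h, Dec enc g h := fun p g => by
    rw [realize_funF (enc := enc) (by norm_num) (by simp [hv'])]
    simp
  simp only [hp, hfun]
  simp only [Function.update_self, ne_eq, Nat.reduceEqDiff,
    not_false_eq_true, Function.update_of_ne, OfNat.zero_ne_ofNat, OfNat.one_ne_ofNat, hv']
  constructor
  · rintro ⟨p, hp, g, hx, ⟨h, hg⟩, hy⟩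
    have : h = fun _ => v 0 := funext fun i =>
      ((hg i _).1 (hx _ (ZFSet.mem_range.2 ⟨i, rfl⟩))).symm
    rw [hp.eq_coll hwf hy hg, this]
  · intro h
    obtain ⟨p, hp, hmem⟩ := exists_partialCollapse hwf henc (v 0)
    refine ⟨p, hp, _, fun i hi => ?_, ⟨_, dec_graph henc fun _ => v 0⟩, h ▸ hmem⟩
    obtain ⟨i, rfl⟩ := ZFSet.mem_range.1 hi
    exact (dec_graph henc _ i _).2 rfl

theorem exists_enc (I : Type u) : ∃ enc : I → ZFSet.{u}, Function.Injective enc := by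
  obtain ⟨e⟩ : Nonempty (I ↪ Ordinal.{u}) := by
    have e : I ≃ (#I).ord.ToType := (Cardinal.eq.1 (mk_ord_toType (#I)).symm).some
    exact ⟨e.toEmbedding.trans
      ⟨fun a => (a.toOrd : Ordinal.{u}), fun a b h => ToType.mk.symm.injective (Subtype.ext h)⟩⟩
  exact ⟨fun i => (e i).toZFSet, fun i j h => e.injective (Ordinal.toZFSet_injective h)⟩

theorem definable_ultraEmb (hwf : WellFounded (UMem W)) :
    (Set.univ : Set ZFSet.{u}).Definable₂ setLang
      {p : ZFSet.{u} × ZFSet.{u} | (ultraEmb hwf p.1 : ZFSet.{u}) = p.2} := by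
  obtain ⟨enc, henc⟩ := exists_enc I
  rw [Set.Definable₂, Set.definable_iff_exists_formula_sum]
  let s : ℕ → (Set.univ : Set ZFSet.{u}) ⊕ Fin 2 := fun k =>
    if k = 0 then Sum.inr 0 else if k = 1 then Sum.inr 1 else
    if k = 2 then Sum.inl ⟨ultraCode W enc, trivial⟩ else Sum.inl ⟨ZFSet.range enc, trivial⟩
  refine ⟨ultraEmbF.relabel s, Set.ext fun x => ?_⟩
  rw [Set.mem_ofPred_eq, Set.mem_ofPred_eq, Set.mem_ofPred_eq, Formula.realize_relabel,
    realize_ultraEmbF hwf henc (by simp [s]) (by simp [s])]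
  simp [s, ultraEmb_apply]

variable {κ : Cardinal.{u}}

theorem isClosedEmbedding_ultraEmb (hwf : WellFounded (UMem W)) (hκ : ℵ₀ < κ)
    (hW : IsComplete κ W) {g : I → Pt κ} (hg : NonConst W g) :
    IsClosedEmbedding κ (ultraEmb hwf) where
  transitive := ultraClass_transitive hwf
  definable := definable_ultraEmb hwf
  fix_below ξ hξ := by simpa [Pt.code] using ultraEmb_code hwf hW (ToType.mk ⟨ξ, hξ⟩)
  move_crit := ultraEmb_kappa_ne hwf hW hg
  closed := ultraClass_closed hwf hκ hW hg

end Definability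

/-! ### The ultrafilter derived from a closed embedding -/

section SeqCode

variable {κ : Cardinal.{u}}

/-- A sequence in `κ^{<κ}` as a set of pairs of ordinals. -/
def SeqLT.code (t : SeqLT κ) : ZFSet.{u} :=
  ZFSet.range fun x : Set.Iio t.1 => ZFSet.pair x.1.code (t.2 x).code

theorem SeqLT.pair_mem_code {t : SeqLT κ} {x : Pt κ} {w : ZFSet.{u}} :
    ZFSet.pair x.code w ∈ t.code ↔ ∃ h : x < t.1, w = (t.2 ⟨x, h⟩).code := by
  simp only [SeqLT.code, ZFSet.mem_range, ZFSet.pair_inj]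
  constructor
  · rintro ⟨⟨y, hy⟩, h1, h2⟩
    obtain rfl := Pt.code_injective h1
    exact ⟨hy, h2.symm⟩
  · rintro ⟨h, rfl⟩
    exact ⟨⟨x, h⟩, rfl, rfl⟩

theorem SeqLT.code_injective : Function.Injective (SeqLT.code (κ := κ)) := by
  intro s t h
  have hle : ∀ s t : SeqLT κ, s.code = t.code → s.1 ≤ t.1 := fun s t h => by
    by_contra! hc
    have : ZFSet.pair t.1.code (s.2 ⟨t.1, hc⟩).code ∈ s.code := SeqLT.pair_mem_code.2 ⟨hc, rfl⟩
    rw [h, SeqLT.pair_mem_code] at this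
    exact lt_irrefl _ this.1
  obtain ⟨a, s⟩ := s
  obtain ⟨b, t⟩ := t
  obtain rfl : a = b := le_antisymm (hle _ _ h) (hle _ _ h.symm)
  congr 1
  funext x
  have : ZFSet.pair x.1.code (s x).code ∈ SeqLT.code ⟨a, s⟩ := SeqLT.pair_mem_code.2 ⟨x.2, rfl⟩
  rw [h, SeqLT.pair_mem_code] at this
  exact Pt.code_injective this.2

theorem SeqLT.exists_code {a : Pt κ} {z : ZFSet.{u}}
    (h1 : ∀ p ∈ z, ∃ x ∈ a.code, ∃ y ∈ κ.ord.toZFSet, p = ZFSet.pair x y)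
    (h2 : ∀ x ∈ a.code, ∃ y, ∀ w, ZFSet.pair x w ∈ z ↔ w = y) : ∃ t : SeqLT κ, t.code = z := by
  have h3 : ∀ x : Set.Iio a, ∃ y : Pt κ, ∀ w, ZFSet.pair x.1.code w ∈ z ↔ w = y.code := by
    intro x
    obtain ⟨y, hy⟩ := h2 x.1.code (Pt.code_mem_code_iff.2 x.2)
    obtain ⟨x', -, y', hy', hxy⟩ := h1 _ ((hy y).2 rfl)
    obtain ⟨-, rfl⟩ := ZFSet.pair_inj.1 hxy
    obtain ⟨b, rfl⟩ := Pt.exists_code.1 hy'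
    exact ⟨b, hy⟩
  choose t ht using h3
  refine ⟨⟨a, t⟩, ?_⟩
  ext p
  simp only [SeqLT.code, ZFSet.mem_range]
  constructor
  · rintro ⟨x, rfl⟩
    exact (ht x _).2 rfl
  · intro hp
    obtain ⟨x, hx, y, -, rfl⟩ := h1 p hp
    obtain ⟨b, hb, rfl⟩ := Pt.exists_code_mem.1 hx
    exact ⟨⟨b, hb⟩, by rw [(ht ⟨b, hb⟩ y).1 hp]⟩

/-- A set of sequences as an element of the universe of sets. -/
def seqSetCode (X : Set (SeqLT κ)) : ZFSet.{u} := ZFSet.range fun t : X => t.1.code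

theorem mem_seqSetCode {X : Set (SeqLT κ)} {z : ZFSet.{u}} :
    z ∈ seqSetCode X ↔ ∃ t ∈ X, t.code = z := by
  simp [seqSetCode]

theorem code_mem_seqSetCode {X : Set (SeqLT κ)} {t : SeqLT κ} :
    t.code ∈ seqSetCode X ↔ t ∈ X := by
  rw [mem_seqSetCode]
  exact ⟨fun ⟨s, hs, h⟩ => SeqLT.code_injective h ▸ hs, fun h => ⟨t, h, rfl⟩⟩

end SeqCode

/-! ### Transfer of first-order facts along an elementary embedding -/

section Elementary

open Language

variable {M : Set ZFSet.{u}} (j : ZFSet.{u} ↪ₑ[setLang] M)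

/-- The assignment of variables given by a list. -/
def asg (l : List ZFSet.{u}) (k : ℕ) : ZFSet.{u} := l.getD k ∅

theorem realize_emb_iff (φ : setLang.Formula ℕ) (v : ℕ → ZFSet.{u}) :
    φ.Realize (fun k => j (v k)) ↔ φ.Realize v :=
  j.map_formula φ v

variable (hM : ∀ x ∈ M, ∀ y ∈ x, y ∈ M)

theorem emb_class (x : M) : @TransModel.emb M _ (transModelClass hM) x = x.1 := rfl

include hM

theorem emb_mem_iff {x y : ZFSet.{u}} : (j x : ZFSet.{u}) ∈ (j y : ZFSet.{u}) ↔ x ∈ y := by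
  let _ := transModelClass hM
  simpa [emb_class, asg] using realize_emb_iff j (memF 0 1) (asg [x, y])

theorem emb_pair (x y : ZFSet.{u}) :
    (j (ZFSet.pair x y) : ZFSet.{u}) = ZFSet.pair (j x) (j y) := by
  let _ := transModelClass hM
  simpa [emb_class, asg] using realize_emb_iff j (pairF 0 1 2) (asg [ZFSet.pair x y, x, y])

theorem emb_subset {x y z : ZFSet.{u}} (h : x ⊆ y) (hz : z ∈ (j x : ZFSet.{u})) :
    z ∈ (j y : ZFSet.{u}) := by
  let _ := transModelClass hM
  have := (realize_emb_iff j (allF 2 (memF 2 0 ⟹ memF 2 1)) (asg [x, y])).2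
    (by simpa [asg] using fun z hz => h hz)
  simp only [realize_allF, Formula.realize_imp, realize_memF, emb_class] at this
  exact this ⟨z, hM _ (j x).2 z hz⟩ hz

theorem mem_emb_inter {x y z : ZFSet.{u}} :
    z ∈ (j (x ∩ y) : ZFSet.{u}) ↔ z ∈ (j x : ZFSet.{u}) ∧ z ∈ (j y : ZFSet.{u}) := by
  let _ := transModelClass hM
  have := (realize_emb_iff j (allF 3 ((memF 3 2).iff (memF 3 0 ⊓ memF 3 1)))
    (asg [x, y, x ∩ y])).2 (by simp [asg])
  simp only [realize_allF, Formula.realize_iff, Formula.realize_inf, realize_memF,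
    emb_class] at this
  exact ⟨fun hz => (this ⟨z, hM _ (j _).2 z hz⟩).1 hz,
    fun hz => (this ⟨z, hM _ (j _).2 z hz.1⟩).2 hz⟩

theorem mem_emb_sdiff {x y z : ZFSet.{u}} :
    z ∈ (j (x \ y) : ZFSet.{u}) ↔ z ∈ (j x : ZFSet.{u}) ∧ z ∉ (j y : ZFSet.{u}) := by
  let _ := transModelClass hM
  have := (realize_emb_iff j (allF 3 ((memF 3 2).iff (memF 3 0 ⊓ ∼(memF 3 1))))
    (asg [x, y, x \ y])).2 (by simp [asg])
  simp only [realize_allF, Formula.realize_iff, Formula.realize_inf, Formula.realize_not,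
    realize_memF, emb_class] at this
  exact ⟨fun hz => (this ⟨z, hM _ (j _).2 z hz⟩).1 hz,
    fun hz => (this ⟨z, hM _ (j _).2 z hz.1⟩).2 hz⟩

theorem isOrdinal_emb {x : ZFSet.{u}} (hx : x.IsOrdinal) : (j x : ZFSet.{u}).IsOrdinal := by
  let _ := transModelClass hM
  have h1 := (realize_emb_iff j
    (allF 1 (memF 1 0 ⟹ allF 2 (memF 2 1 ⟹ (memF 2 0 ⊓ allF 3 (memF 3 2 ⟹ memF 3 1)))))
    (asg [x])).2 (by
      simpa [asg] using fun y hy z hz => ⟨hx.mem_trans hz hy, fun w hw => (hx.mem hy).mem_trans hw hz⟩)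
  simp only [realize_allF, Formula.realize_imp, Formula.realize_inf, realize_memF,
    emb_class] at h1
  rw [ZFSet.isOrdinal_iff_forall_mem_isTransitive]
  have h2 : ∀ y ∈ (j x : ZFSet.{u}), ∀ z ∈ y, z ∈ (j x : ZFSet.{u}) ∧ ∀ w ∈ z, w ∈ y :=
    fun y hy z hz => by
      have hyM := hM _ (j x).2 y hy
      have hzM := hM _ hyM z hz
      obtain ⟨h3, h4⟩ := h1 ⟨y, hyM⟩ hy ⟨z, hzM⟩ hz
      exact ⟨h3, fun w hw => h4 ⟨w, hM _ hzM w hw⟩ hw⟩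
  exact ⟨fun y hy z hz => (h2 y hy z hz).1, fun y hy z hz w hw => (h2 y hy z hz).2 w hw⟩

/-- Reflection of the covering of `A \ B` by the complements of a family of sets. -/
theorem exists_notMem_of_emb {A B δ F z : ZFSet.{u}}
    (h : ∀ z ∈ A, z ∉ B → ∃ ξ ∈ δ, ∀ Y, ZFSet.pair ξ Y ∈ F → z ∉ Y)
    (hz : z ∈ (j A : ZFSet.{u})) (hz' : z ∉ (j B : ZFSet.{u})) :
    ∃ ξ ∈ (j δ : ZFSet.{u}), ∀ Y ∈ M, ZFSet.pair ξ Y ∈ (j F : ZFSet.{u}) → z ∉ Y := by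
  let _ := transModelClass hM
  have := (realize_emb_iff j (allF 4 (memF 4 0 ⟹ (∼(memF 4 1) ⟹
    exF 5 (memF 5 2 ⊓ allF 6 (pmemF 5 6 3 ⟹ ∼(memF 4 6)))))) (asg [A, B, δ, F])).2
    (by simpa [asg, Formula.realize_imp, Formula.realize_inf, Formula.realize_not] using h)
  simp only [realize_allF, realize_exF, Formula.realize_imp, Formula.realize_inf,
    Formula.realize_not, realize_memF, realize_pmemF, emb_class] at this
  obtain ⟨ξ, hξ, h'⟩ := this ⟨z, hM _ (j A).2 z hz⟩ hz hz'
  exact ⟨ξ, hξ, fun Y hY => h' ⟨Y, hY⟩⟩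

/-- Used with `A` all sequences, `X` a subset of `κ` and `B` the sequences whose value at `ξ` lies
in `X`: it computes the projection of the derived ultrafilter under evaluation. -/
theorem mem_emb_of_pair_mem {A B X ξ z q : ZFSet.{u}}
    (h : ∀ z ∈ A, ∀ q ∈ X, ZFSet.pair ξ q ∈ z → z ∈ B)
    (hz : z ∈ (j A : ZFSet.{u})) (hq : q ∈ (j X : ZFSet.{u}))
    (hp : ZFSet.pair (j ξ) q ∈ z) : z ∈ (j B : ZFSet.{u}) := by
  let _ := transModelClass hM
  have := (realize_emb_iff j (allF 4 (memF 4 0 ⟹ allF 5 (memF 5 2 ⟹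
    (pmemF 3 5 4 ⟹ memF 4 1)))) (asg [A, B, X, ξ])).2
    (by simpa [asg, Formula.realize_imp] using h)
  simp only [realize_allF, Formula.realize_imp, realize_memF, realize_pmemF, emb_class] at this
  exact this ⟨z, hM _ (j A).2 z hz⟩ hz ⟨q, hM _ (j X).2 q hq⟩ hq hp

/-- For `K = κ` and `A = κ^{<κ}`, this recognises a function in `M` from some `a < j(κ)` to `j(κ)`
as a member of `j(κ^{<κ})`. -/
theorem mem_emb_of_isFunction {A K a f : ZFSet.{u}}
    (h : ∀ z, ∀ a ∈ K, (∀ p ∈ z, ∃ x ∈ a, ∃ y ∈ K, p = ZFSet.pair x y) →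
      (∀ x ∈ a, ∃ y, ∀ w, ZFSet.pair x w ∈ z ↔ w = y) → z ∈ A)
    (ha : a ∈ (j K : ZFSet.{u})) (hf : f ∈ M)
    (h1 : ∀ p ∈ f, ∃ x ∈ a, ∃ y ∈ (j K : ZFSet.{u}), p = ZFSet.pair x y)
    (h2 : ∀ x ∈ a, ∃ y ∈ M, ∀ w, ZFSet.pair x w ∈ f ↔ w = y) : f ∈ (j A : ZFSet.{u}) := by
  let _ := transModelClass hM
  have := (realize_emb_iff j (allF 2 (allF 3 (memF 3 1 ⟹
    (allF 4 (memF 4 2 ⟹ exF 5 (memF 5 3 ⊓ exF 6 (memF 6 1 ⊓ pairF 4 5 6))) ⟹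
    (allF 5 (memF 5 3 ⟹ exF 6 (allF 7 ((pmemF 5 7 2).iff (eqF 7 6)))) ⟹ memF 2 0)))))
    (asg [A, K])).2
    (by simpa [asg, Formula.realize_imp, Formula.realize_inf, Formula.realize_iff] using h)
  simp only [realize_allF, realize_exF, realize_eqF, Formula.realize_imp, Formula.realize_inf,
    Formula.realize_iff, realize_memF, realize_pmemF, realize_pairF, emb_class] at this
  have haM := hM _ (j K).2 a ha
  refine this ⟨f, hf⟩ ⟨a, haM⟩ ha ?_ ?_
  · rintro ⟨p, hp⟩ hpf
    obtain ⟨x, hx, y, hy, rfl⟩ := h1 p hpf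
    exact ⟨⟨x, hM _ haM x hx⟩, hx, ⟨y, hM _ (j K).2 y hy⟩, hy, rfl⟩
  · rintro ⟨x, hx⟩ hxa
    obtain ⟨y, hy, h⟩ := h2 x hxa
    exact ⟨⟨y, hy⟩, fun w => (h w).trans (show w.1 = y ↔ w = ⟨y, hy⟩ from ⟨fun h => Subtype.ext h, congrArg Subtype.val⟩)⟩

end Elementary

/-! ### Ultrafilters on `κ^{<κ}` derived from a closed embedding -/

section Derived

variable {κ : Cardinal.{u}} {M : Set ZFSet.{u}} {j : ZFSet.{u} ↪ₑ[setLang] M}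

theorem IsClosedEmbedding.kappa_mem (hj : IsClosedEmbedding κ j) :
    κ.ord.toZFSet ∈ (j κ.ord.toZFSet : ZFSet.{u}) := by
  have h1 := isOrdinal_emb j hj.transitive (ZFSet.isOrdinal_toZFSet κ.ord)
  refine (ZFSet.IsOrdinal.eq_or_mem_of_subset (ZFSet.isOrdinal_toZFSet _) h1 ?_).resolve_left
    fun h => hj.move_crit h.symm
  intro z hz
  obtain ⟨ξ, hξ, rfl⟩ := Ordinal.mem_toZFSet_iff.1 hz
  rw [← hj.fix_below ξ hξ, emb_mem_iff j hj.transitive]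
  exact hz

theorem IsClosedEmbedding.emb_code (hj : IsClosedEmbedding κ j) (a : Pt κ) :
    (j a.code : ZFSet.{u}) = a.code :=
  hj.fix_below _ a.toOrd.2

theorem subsetCode_univ : subsetCode (Set.univ : Set (Pt κ)) = κ.ord.toZFSet := by
  ext z
  rw [mem_subsetCode, Pt.exists_code]
  simp

theorem IsSeed.mem_emb_kappa {η : Ordinal.{u}} {U : Ultrafilter (Pt κ)} (h : IsSeed j η U) :
    η.toZFSet ∈ (j κ.ord.toZFSet : ZFSet.{u}) := by
  rw [← subsetCode_univ]
  exact (h Set.univ).1 Filter.univ_mem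

/-- The ultrafilter on `κ^{<κ}` derived from `j` and a member of `j(κ^{<κ})`. -/
def derived (j : ZFSet.{u} ↪ₑ[setLang] M) (hM : ∀ x ∈ M, ∀ y ∈ x, y ∈ M) (f : ZFSet.{u})
    (hf : f ∈ (j (seqSetCode (Set.univ : Set (SeqLT κ))) : ZFSet.{u})) :
    Ultrafilter (SeqLT κ) :=
  Ultrafilter.ofComplNotMemIff
    { sets := {X | f ∈ (j (seqSetCode X) : ZFSet.{u})}
      univ_sets := hf
      sets_of_superset := fun {X Y} hX hXY => emb_subset j hM (fun z hz => by
        obtain ⟨t, ht, rfl⟩ := mem_seqSetCode.1 hz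
        exact code_mem_seqSetCode.2 (hXY ht)) hX
      inter_sets := fun {X Y} hX hY => by
        have : seqSetCode (X ∩ Y) = seqSetCode X ∩ seqSetCode Y := by
          ext z
          rw [ZFSet.mem_inter]
          constructor
          · intro hz
            obtain ⟨t, ht, rfl⟩ := mem_seqSetCode.1 hz
            exact ⟨code_mem_seqSetCode.2 ht.1, code_mem_seqSetCode.2 ht.2⟩
          · rintro ⟨hz, hz'⟩
            obtain ⟨t, ht, rfl⟩ := mem_seqSetCode.1 hz
            exact code_mem_seqSetCode.2 ⟨ht, code_mem_seqSetCode.1 hz'⟩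
        change f ∈ (j (seqSetCode (X ∩ Y)) : ZFSet.{u})
        rw [this, mem_emb_inter j hM]
        exact ⟨hX, hY⟩ } <| by
    intro X
    have : seqSetCode Xᶜ = seqSetCode (Set.univ : Set (SeqLT κ)) \ seqSetCode X := by
      ext z
      rw [ZFSet.mem_sdiff]
      constructor
      · intro hz
        obtain ⟨t, ht, rfl⟩ := mem_seqSetCode.1 hz
        exact ⟨code_mem_seqSetCode.2 trivial, fun h => ht (code_mem_seqSetCode.1 h)⟩
      · rintro ⟨hz, hz'⟩
        obtain ⟨t, ht, rfl⟩ := mem_seqSetCode.1 hz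
        exact code_mem_seqSetCode.2 fun h => hz' (code_mem_seqSetCode.2 h)
    change ¬ f ∈ (j (seqSetCode Xᶜ) : ZFSet.{u}) ↔ f ∈ (j (seqSetCode X) : ZFSet.{u})
    rw [this, mem_emb_sdiff j hM]
    tauto

theorem mem_derived {hM : ∀ x ∈ M, ∀ y ∈ x, y ∈ M} {f : ZFSet.{u}}
    {hf : f ∈ (j (seqSetCode (Set.univ : Set (SeqLT κ))) : ZFSet.{u})} {X : Set (SeqLT κ)} :
    X ∈ derived j hM f hf ↔ f ∈ (j (seqSetCode X) : ZFSet.{u}) :=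
  Iff.rfl

theorem isComplete_derived (hj : IsClosedEmbedding κ j) {f : ZFSet.{u}}
    (hf : f ∈ (j (seqSetCode (Set.univ : Set (SeqLT κ))) : ZFSet.{u})) :
    IsComplete κ (derived j hj.transitive f hf) := by
  refine isComplete_iff.2 fun ι p hι h => ?_
  obtain ⟨e⟩ : Nonempty (ι ≃ (#ι).ord.ToType) := Cardinal.eq.1 (mk_ord_toType (#ι)).symm
  let ξ : ι → Ordinal.{u} := fun x => (e x).toOrd
  have hξ : ∀ x, ξ x < (#ι).ord := fun x => (e x).toOrd.2
  have hξκ : ∀ x, ξ x < κ.ord := fun x => (hξ x).trans (ord_lt_ord.2 hι)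
  have hinj : ∀ x y, (ξ x).toZFSet = (ξ y).toZFSet → x = y := fun x y h =>
    e.injective (ToType.mk.symm.injective (Subtype.ext (Ordinal.toZFSet_injective h)))
  have hsurj : ∀ ζ < (#ι).ord, ∃ x, ξ x = ζ := fun ζ hζ =>
    ⟨e.symm (ToType.mk ⟨ζ, hζ⟩), by simp [ξ]⟩
  let F : ZFSet.{u} := ZFSet.range fun x => ZFSet.pair (ξ x).toZFSet (seqSetCode {t | p t x})
  by_contra hc
  obtain ⟨ζ, hζ, hζ'⟩ := exists_notMem_of_emb j hj.transitive
    (A := seqSetCode (Set.univ : Set (SeqLT κ))) (B := seqSetCode {t : SeqLT κ | ∀ x, p t x})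
    (δ := (#ι).ord.toZFSet) (F := F) (z := f) (fun z hz hz' => by
      obtain ⟨t, -, rfl⟩ := mem_seqSetCode.1 hz
      rw [code_mem_seqSetCode, Set.mem_ofPred_eq, not_forall] at hz'
      obtain ⟨x, hx⟩ := hz'
      refine ⟨(ξ x).toZFSet, Ordinal.toZFSet_mem_toZFSet_iff.2 (hξ x), fun Y hY => ?_⟩
      obtain ⟨y, hy⟩ := ZFSet.mem_range.1 hY
      obtain ⟨h1, rfl⟩ := ZFSet.pair_inj.1 hy
      obtain rfl := hinj _ _ h1
      rwa [code_mem_seqSetCode]) hf (fun h => hc (mem_derived.2 h))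
  -- The family has length below the critical point, so `j` fixes the length: the index found in `M`
  -- is a genuine index of the family, and `j` of that member was assumed to contain `f`.
  rw [hj.fix_below _ (ord_lt_ord.2 hι)] at hζ
  obtain ⟨ζ, hζι, rfl⟩ := Ordinal.mem_toZFSet_iff.1 hζ
  obtain ⟨x, rfl⟩ := hsurj ζ hζι
  refine hζ' _ (j (seqSetCode {t | p t x})).2 ?_ (mem_derived.1 (h x))
  rw [← hj.fix_below _ (hξκ x), ← emb_pair j hj.transitive, emb_mem_iff j hj.transitive]
  exact ZFSet.mem_range.2 ⟨x, rfl⟩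

open Classical in
/-- Evaluation of a sequence at `a`, with a default value outside its domain. -/
def SeqLT.eval (a : Pt κ) (t : SeqLT κ) : Pt κ :=
  if h : a < t.1 then t.2 ⟨a, h⟩ else a

theorem IsClosedEmbedding.exists_ultrafilter (hj : IsClosedEmbedding κ j)
    {U : Pt κ → Ultrafilter (Pt κ)} {η : Pt κ → Ordinal.{u}} (hη : ∀ a, IsSeed j (η a) (U a)) :
    ∃ W : Ultrafilter (SeqLT κ), IsComplete κ W ∧ ∀ a, W.map (SeqLT.eval a) = U a := by
  have hM := hj.transitive
  set f := graph Pt.code fun a => (η a).toZFSet with hfdef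
  have hdec : Dec Pt.code f fun a => (η a).toZFSet := dec_graph Pt.code_injective _
  have hηM : ∀ a, (η a).toZFSet ∈ M := fun a => hM _ (j _).2 _ (hη a).mem_emb_kappa
  have hfmem : ∀ p ∈ f, ∃ a : Pt κ, p = ZFSet.pair a.code (η a).toZFSet := fun p hp => by
    obtain ⟨a, ha⟩ := ZFSet.mem_range.1 hp
    exact ⟨a, ha.symm⟩
  have hfM : f ∈ M := by
    refine hj.closed f (ZFSet.range fun a => (η a).toZFSet) ⟨fun p hp => ?_, fun z hz => ?_⟩
      fun z hz => ?_
    · obtain ⟨a, rfl⟩ := hfmem p hp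
      exact ZFSet.pair_mem_prod.2 ⟨Pt.exists_code.2 ⟨a, rfl⟩, ZFSet.mem_range.2 ⟨a, rfl⟩⟩
    · obtain ⟨a, rfl⟩ := Pt.exists_code.1 hz
      exact ⟨_, (hdec a _).2 rfl, fun w hw => (hdec a w).1 hw⟩
    · obtain ⟨a, rfl⟩ := ZFSet.mem_range.1 hz
      exact hηM a
  have hf : f ∈ (j (seqSetCode (Set.univ : Set (SeqLT κ))) : ZFSet.{u}) := by
    -- Here `κ ∈ j(κ)` makes `κ` an admissible length for a sequence in `j(κ^{<κ})`.
    refine mem_emb_of_isFunction j hM (fun z a ha h1 h2 => ?_) hj.kappa_mem hfM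
      (fun p hp => ?_) (fun x hx => ?_)
    · obtain ⟨a, rfl⟩ := Pt.exists_code.1 ha
      obtain ⟨t, rfl⟩ := SeqLT.exists_code h1 h2
      exact code_mem_seqSetCode.2 trivial
    · obtain ⟨a, rfl⟩ := hfmem p hp
      exact ⟨_, Pt.exists_code.2 ⟨a, rfl⟩, _, (hη a).mem_emb_kappa, rfl⟩
    · obtain ⟨a, rfl⟩ := Pt.exists_code.1 hx
      exact ⟨_, hηM a, hdec a⟩
  -- One inclusion between ultrafilters already gives equality.
  refine ⟨derived j hM f hf, isComplete_derived hj hf, fun a => Ultrafilter.coe_le_coe.1 ?_⟩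
  intro X hX
  change f ∈ (j (seqSetCode (SeqLT.eval a ⁻¹' X)) : ZFSet.{u})
  refine mem_emb_of_pair_mem j hM (fun z hz q hq hp => ?_) hf ((hη a X).1 hX)
    (ξ := a.code) ?_
  · obtain ⟨t, -, rfl⟩ := mem_seqSetCode.1 hz
    obtain ⟨h, rfl⟩ := SeqLT.pair_mem_code.1 hp
    rw [code_mem_seqSetCode, Set.mem_preimage, SeqLT.eval, dif_pos h]
    exact code_mem_subsetCode.1 hq
  · rw [hj.emb_code]
    exact (hdec a _).2 rfl

end Derived

/-! ### Equivalence of gluing and directedness -/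

section Main

variable {κ lam : Cardinal.{u}}

theorem IsMeasurable.exists_upperBound (hκ : IsMeasurable κ) {ι : Type*} [Nonempty ι]
    {U : ι → Ultrafilter (Pt κ)} (hU : ∀ i, U i ∈ CompleteUltrafilters κ)
    {W : Ultrafilter (SeqLT κ)} (hW : IsComplete κ W) {g : ι → SeqLT κ → Pt κ}
    (hg : ∀ i, W.map (g i) = U i) :
    ∃ W' ∈ CompleteUltrafilters κ, ∀ i, RKLE (U i) W' := by
  obtain ⟨e⟩ : Nonempty (SeqLT κ ↪ Pt κ) := by
    rw [← Cardinal.le_def, mk_ord_toType]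
    exact hκ.mk_seqLT_le
  have : Nonempty (SeqLT κ) := (W : Filter _).nonempty_of_neBot
  have key : ∀ i, (W.map e).map (g i ∘ Function.invFun e) = U i := fun i => by
    rw [Ultrafilter.map_map, Function.comp_assoc, Function.invFun_comp e.injective,
      Function.comp_id, hg]
  exact ⟨W.map e, mem_completeUltrafilters_of_map (hW.map e) (hU (Classical.arbitrary ι)) (key _),
    fun i => rkle_iff_exists_map.2 ⟨_, key i⟩⟩

/-- The seed lies in `j(κ)`, so a function representing it takes values in `κ` almost everywhere,
and membership of its class in `j(X)` is membership of the preimage of `X` in `W`. -/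
theorem exists_map_of_isSeed {I : Type u} {W : Ultrafilter I} {M : Set ZFSet.{u}}
    {j : ZFSet.{u} ↪ₑ[setLang] M} (hj : IsUltrapowerEmbedding W j) {η : Ordinal.{u}}
    {U : Ultrafilter (Pt κ)} (hη : IsSeed j η U) : ∃ g : I → Pt κ, W.map g = U := by
  obtain ⟨hM, π, hπ, hconst⟩ := hj
  obtain ⟨a, ha⟩ := π.surjective ⟨η.toZFSet, hM _ (j _).2 _ hη.mem_emb_kappa⟩
  induction a using Filter.Germ.inductionOn with
  | _ h =>
  have hmem : ∀ X : Set (Pt κ), X ∈ U ↔ ∀ᶠ i in (W : Filter I), h i ∈ subsetCode X := fun X => by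
    rw [hη X, hconst, ← hπ, ha]
  have hex : ∀ᶠ i in (W : Filter I), ∃ b : Pt κ, b.code = h i := by
    filter_upwards [(hmem Set.univ).1 Filter.univ_mem] with i hi
    obtain ⟨b, -, hb⟩ := mem_subsetCode.1 hi
    exact ⟨b, hb⟩
  have : Nonempty (Pt κ) := (U : Filter _).nonempty_of_neBot
  obtain ⟨g, hg⟩ := hex.choice
  refine ⟨g, Ultrafilter.ext fun X => ?_⟩
  rw [hmem, Ultrafilter.mem_map]
  refine Filter.eventually_congr (hg.mono fun i hi => ?_)
  rw [← hi, code_mem_subsetCode]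

/-- Extending a family of at most `lam` ultrafilters to a sequence of length `lam`. -/
theorem RKDirected.of_sequences (hκ : IsMeasurable κ)
    (h : ∀ U : Set.Iio lam.ord → Ultrafilter (Pt κ), (∀ β, U β ∈ CompleteUltrafilters κ) →
      ∃ W ∈ CompleteUltrafilters κ, ∀ β, RKLE (U β) W) : RKDirected κ (Order.succ lam) := by
  intro ι U hι hU
  rcases isEmpty_or_nonempty ι with hι' | hι'
  · obtain ⟨W, hW⟩ := hκ.2
    exact ⟨W, hW, fun i => hι'.elim i⟩
  obtain ⟨e⟩ : Nonempty (ι ↪ lam.ord.ToType) := by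
    rw [← Cardinal.le_def, mk_ord_toType]
    exact Order.lt_succ_iff.1 hι
  obtain ⟨W, hW, hle⟩ := h (fun β => U (Function.invFun e (ToType.mk β))) fun β => hU _
  refine ⟨W, hW, fun i => ?_⟩
  have := hle (e i).toOrd
  simpa [Function.leftInverse_invFun e.injective i] using this

theorem HasWeakGPViaUltrafilters.rkDirected (hκ : IsMeasurable κ) (hlam : ℵ₀ ≤ lam)
    (h : HasWeakGPViaUltrafilters κ lam.ord) : RKDirected κ (Order.succ lam) := by
  refine RKDirected.of_sequences hκ fun U hU => ?_
  obtain ⟨W, M, j, η, hW, hj, -, hη⟩ := h U hU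
  choose g hg using fun β => exists_map_of_isSeed hj (hη β)
  have : Nonempty (Set.Iio lam.ord) :=
    ⟨⟨0, Cardinal.ord_pos.2 (aleph0_pos.trans_le hlam)⟩⟩
  exact hκ.exists_upperBound hU hW hg

theorem HasWeakGP.rkDirected (hκ : IsMeasurable κ) (hlam : ℵ₀ ≤ lam) (hle : lam ≤ κ)
    (h : HasWeakGP κ lam.ord) : RKDirected κ (Order.succ lam) := by
  refine RKDirected.of_sequences hκ fun U hU => ?_
  obtain ⟨M, j, η, hj, hη⟩ := h U hU
  have h0 : (0 : Ordinal.{u}) < lam.ord := Cardinal.ord_pos.2 (aleph0_pos.trans_le hlam)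
  have : Nonempty (Set.Iio lam.ord) := ⟨⟨0, h0⟩⟩
  have hle' : lam.ord ≤ κ.ord := ord_le_ord.2 hle
  classical
  -- Pads the sequence to length `κ` by repeating its first term, since the closure of `M` is stated
  -- for functions with domain exactly `κ`.
  let r : Pt κ → Set.Iio lam.ord := fun a =>
    if ha : (a.toOrd : Ordinal.{u}) < lam.ord then ⟨a.toOrd, ha⟩ else ⟨0, h0⟩
  obtain ⟨W, hW, hmap⟩ := hj.exists_ultrafilter (U := U ∘ r) (η := η ∘ r) fun a => hη (r a)
  refine hκ.exists_upperBound hU hW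
    (g := fun β => SeqLT.eval (ToType.mk ⟨β, β.2.trans_le hle'⟩)) fun β => ?_
  rw [hmap]
  have hβ : (β : Ordinal.{u}) < lam.ord := β.2
  simp [r, hβ]

theorem RKDirected.hasGPViaUltrafilters (hκ : IsMeasurable κ)
    (hdir : RKDirected κ (Order.succ lam)) {β : Ordinal.{u}} (hβ : β < (Order.succ lam).ord) :
    HasGPViaUltrafilters κ β := by
  intro U hU
  classical
  obtain ⟨U₀, hU₀⟩ := hκ.2
  obtain ⟨W, hW, f, hf, hlt⟩ := hdir.exists_glues hκ.1
    (U := fun γ => if h : γ < β then U ⟨γ, h⟩ else U₀)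
    (fun γ => by
      by_cases h : γ < β
      · simpa [h] using hU _
      · simpa [h] using hU₀) β hβ
  -- Any injection of `κ` into `κ^{<κ}` would do to move `W`; the length of the sequence recovers
  -- the point, so `d` inverts `e`.
  let e : Pt κ → SeqLT κ := fun a => ⟨a, fun _ => a⟩
  let d : SeqLT κ → Pt κ := Sigma.fst
  have hW' : IsComplete κ (W.map e) := hW.1.map e
  have hwf : WellFounded (UMem (W.map e)) := hW'.wellFounded hκ.1 ZFSet.mem_wf
  have hseed := fun γ : Set.Iio β => exists_isSeed hwf (U γ) (f γ ∘ d) (by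
    rw [Ultrafilter.map_map]
    have := hf γ γ.2
    beta_reduce at this
    rw [dif_pos (show (γ : Ordinal.{u}) < β from γ.2)] at this
    exact this)
  refine ⟨W.map e, ultraClass hwf, ultraEmb hwf, _, hW', isUltrapowerEmbedding_ultraEmb hwf,
    isClosedEmbedding_ultraEmb hwf hκ.1 hW' (g := d) fun a ha => hW.2 a ha, ?_,
    fun γ => (hseed γ).1⟩
  intro γ δ hγδ
  rw [← Ordinal.toZFSet_mem_toZFSet_iff, (hseed γ).2, (hseed δ).2, coll_mem_coll_iff]
  refine Filter.Eventually.mono ?_ fun i hi => Pt.code_mem_code_iff.2 hi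
  exact hlt δ δ.2 γ hγδ

theorem HasGPViaUltrafilters.hasGP {α : Ordinal.{u}} (h : HasGPViaUltrafilters κ α) :
    HasGP κ α := fun U hU => by
  obtain ⟨-, M, j, η, -, -, h⟩ := h U hU
  exact ⟨M, j, η, h⟩

theorem HasWeakGPViaUltrafilters.hasWeakGP {α : Ordinal.{u}}
    (h : HasWeakGPViaUltrafilters κ α) : HasWeakGP κ α := fun U hU => by
  obtain ⟨-, M, j, η, -, -, h⟩ := h U hU
  exact ⟨M, j, η, h⟩

theorem HasGP.hasWeakGP {α : Ordinal.{u}} (h : HasGP κ α) : HasWeakGP κ α := fun U hU => by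
  obtain ⟨M, j, η, hj, -, h⟩ := h U hU
  exact ⟨M, j, η, hj, h⟩

theorem HasGPViaUltrafilters.hasWeakGPViaUltrafilters {α : Ordinal.{u}}
    (h : HasGPViaUltrafilters κ α) : HasWeakGPViaUltrafilters κ α := fun U hU => by
  obtain ⟨W, M, j, η, hW, hj, hj', -, h⟩ := h U hU
  exact ⟨W, M, j, η, hW, hj, hj', h⟩

end Main

end Gluing

end

theorem mainTheorem2 (κ lam : Cardinal.{u}) (hκ : Gluing.IsMeasurable κ)
    (hlam : ℵ₀ ≤ lam) (hlam' : lam ≤ 2 ^ κ) :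
    List.TFAE
      [Gluing.HasGPBelowViaUltrafilters κ (Order.succ lam).ord,
       Gluing.HasGPViaUltrafilters κ lam.ord,
       Gluing.HasWeakGPViaUltrafilters κ lam.ord,
       Gluing.RKDirected κ (Order.succ lam)] ∧
    (lam ≤ κ →
      (Gluing.HasGPBelowViaUltrafilters κ (Order.succ lam).ord ↔
        Gluing.HasGPBelow κ (Order.succ lam).ord) ∧
      (Gluing.HasGPViaUltrafilters κ lam.ord ↔ Gluing.HasGP κ lam.ord) ∧
      (Gluing.HasWeakGPViaUltrafilters κ lam.ord ↔ Gluing.HasWeakGP κ lam.ord)) := by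
  have hω : ω ≤ lam.ord := by rwa [← ord_aleph0, ord_le_ord]
  have hlt : lam.ord < (Order.succ lam).ord := ord_lt_ord.2 (Order.lt_succ lam)
  have h41 : Gluing.RKDirected κ (Order.succ lam) →
      Gluing.HasGPBelowViaUltrafilters κ (Order.succ lam).ord :=
    fun h β _ hβ => h.hasGPViaUltrafilters hκ hβ
  refine ⟨?_, fun hle => ⟨⟨fun h β h1 h2 => (h β h1 h2).hasGP, fun h => ?_⟩,
    ⟨fun h => h.hasGP, fun h => ?_⟩, fun h => h.hasWeakGP, fun h => ?_⟩⟩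
  · tfae_have 1 → 2 := fun h => h _ hω hlt
    tfae_have 2 → 3 := fun h => h.hasWeakGPViaUltrafilters
    tfae_have 3 → 4 := fun h => h.rkDirected hκ hlam
    tfae_have 4 → 1 := h41
    tfae_finish
  -- The instance at the ordinal `lam.ord` alone already forces directedness, which returns gluing
  -- via ultrafilters at every length.
  · exact h41 ((h _ hω hlt).hasWeakGP.rkDirected hκ hlam hle)
  · exact (h.hasWeakGP.rkDirected hκ hlam hle).hasGPViaUltrafilters hκ hlt
  · exact ((h.rkDirected hκ hlam hle).hasGPViaUltrafilters hκ hlt).hasWeakGPViaUltrafilters
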